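/- **Setting.** In each stage $i=1,2,\dots$ two networks are used once each, one for long and one for short packets. A network is a finite directed hypergraph with a source Alice and a sink Bob; the node set and the number of hyperedges are fixed. Each hyperedge carries one packet over $\mathbb F_q$ from its tail to all nodes of its head, hyperedges are used in a fixed order, and every node other than Alice sends linear combinations, with independent uniform coefficients from $\mathbb F_q$, of the packets it has received so far in the stage. The adversary Calvin chooses a set of hyperedges in each network and adds arbitrary packets there. For long packets let $M_i$ be the min cut from Alice to Bob, $z_i$ a bound on the min cut from the attacked hyperedges to Bob, and $c_i$ the number of transmissions of Alice; write $\bar M_i,\bar z_i,\bar c_i$ for the same quantities for short packets. Assume $z_i\le M_i$ and $c_i,\bar c_i\le\bar c$ for all $i$. The networks and the numbers $z_i,\bar z_i$ are random, with a law that does not depend on $q$, and independent of all coding symbols and secrets. Calvin knows them, the message, all coding coefficients and all symbols that Alice sends (even future ones), but not the secrets shared by Alice and Bob; his strategy is otherwise arbitrary (measurable). **Scheme.** Fix integers $b,\sigma\ge1$ and $m$ with $\sigma\le\bar M_i-\bar z_i$ for all $i$ and $\sigma m\ge 2b\bar c+2\sigma\bar c+1$. The message is $W\in\mathbb F_q^{b\times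 n}$, with column-stacked vector $w$, and $X_0=(W\ I_b)$. For each $k\ge1$ Alice and Bob share $2\alpha_k$ independent uniform symbols $d^{(k)}_u,h^{(k)}_u\in\mathbb F_q$, where $\alpha_k=k\sigma m$. With $D_k=\big((d^{(k)}_u)^v\big)_{u\le\alpha_k,\,v\le nb}$ put $l_k=h_k-D_kw$, and arrange $l_k$ as a $\sigma\times km$ matrix $\mathcal L_k$. Let $L^{(i)}=(\Lambda^{(i)}\ I_{i\sigma})$, where the $k$-th block row of $\Lambda^{(i)}$ is $(\mathcal L_k\ 0)\in\mathbb F_q^{\sigma\times im}$. In stage $i$ Alice sends the rows of $K_iX_0$ as long packets and the rows of $G_iL^{(i)}$ as short packets, with independent uniform random matrices $K_i,G_i$. Let $Y^{(i)}$ be the matrix of all long packets received by Bob in stages $1,\dots,i$, and $J^{(i)}$ that of all short packets, zero-padded to width $i(m+\sigma)$ with the blocks of the front $im$ and of the last $i\sigma$ columns aligned. After stage $i$ Bob selects a maximal set of linearly independent rows of $Y^{(i)}$ and, for these rows, a basis of the column space consisting of the last $b$ columns $\hat T$ and further columns $T''$. He expands the first $n$ columns as $T''F^Z+\hat TF^X$.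 He treats $J^{(i)}$ likewise, with its last $i\sigma$ columns $\hat{\bar T}$ and coefficients $F^E,F^A$. He then solves, for unknowns $W',l_1',\dots,l_i'$, $$\hat T(W'-W'_aF^Z)=\hat TF^X,\qquad \hat{\bar T}(\Lambda'-\Lambda'_aF^E)=\hat{\bar T}F^A,\qquad D_kw'+l'_k=h_k\ (1\le k\le i),$$ where $w'$ is the column-stacked vector of $W'$, $\Lambda'$ is formed from the $l_k'$ as $\Lambda^{(i)}$ is from the $l_k$, and the subscript $a$ denotes the columns in the positions of the chosen front basis columns. If such bases or a solution do not exist, he waits for the next stage; if the solution is unique, he outputs $W'$ and stops; otherwise he declares failure and stops. **Theorem.** Let the pairs $(M_i,z_i)$, $i\ge1$, be i.i.d., with means $\mathbb E[M]$ and $\mathbb E[z]$ satisfying $\mathbb E[M]-\mathbb E[z]\ge\varepsilon$ for some $\varepsilon>0$. Let $N=\min\{i: b+\sum_{j\le i}z_j\le\sum_{j\le i}M_j\}$. Then: 1. $N<\infty$ almost surely. 2. $\displaystyle \mathbb E\Big[\frac bN\Big]\ \ge\ \frac{b}{b+\bar c-1}\,\big(\mathbb E[M]-\mathbb E[z]\big).$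 3. For every $n$ and every $\delta>0$ there is $q_0$ such that, for every finite field with $q\ge q_0$ elements, every message, every strategy of Calvin and every way in which Bob chooses his bases: with probability at least $1-\delta$, Bob stops after at most $N$ stages and outputs $W$. Moreover, if $\tau$ is the stage at which Bob stops, then $\displaystyle\mathbb E\Big[\frac b\tau\mathbf 1_{\{\text{Bob outputs }W\}}\Big]\ge\frac{b}{b+\bar c-1}\big(\mathbb E[M]-\mathbb E[z]\big)-\delta.$ 4. The overhead (identity columns and short packets) is negligible for long messages: $\displaystyle\mathbb E\Big[\frac{bn}{\sum_{i=1}^{N}\big(n+b+i(m+\sigma)\big)}\Big]\to\mathbb E\Big[\frac bN\Big]$ as $n\to\infty$. -/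

import Mathlib

open MeasureTheory ProbabilityTheory Filter Topology

namespace RatelessCode

/-! ### One use of the network: hypergraph, min cut, random linear network coding -/

/-- A directed hypergraph with nodes `V` and `ne` hyperedges, each of which carries one packet.
The hyperedge `e` is a transmission by the node `tail e`, received by all nodes of `head e`.
Hyperedges are listed in the order of transmission (for an acyclic network, any topological
order).  A hyperedge with an empty head is a transmission that nobody receives. -/
structure Network (V : Type*) (ne : ℕ) where
  tail : Fin ne → V
  head : Fin ne → Finset V

instance {V : Type*} {ne : ℕ} : MeasurableSpace (Network V ne) := ⊤

namespace Network

variable {V : Type*} {ne : ℕ}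

/-- The packet on `e'` is mixed by an internal node into the packet on `e`. The source `alice`
does not mix: her transmissions are produced by the encoder. -/
def Feeds (N : Network V ne) (alice : V) (e' e : Fin ne) : Prop :=
  e' < e ∧ N.tail e ≠ alice ∧ N.tail e ∈ N.head e'

/-- Removing the hyperedges of `C` destroys every path that starts with a hyperedge of `S`
and ends with a hyperedge received by `bob`. -/
def Separates (N : Network V ne) (alice bob : V) (S C : Finset (Fin ne)) : Prop :=
  ∀ e₀ ∈ S, e₀ ∉ C → ∀ e,
    Relation.ReflTransGen (fun a a' => N.Feeds alice a a' ∧ a' ∉ C) e₀ e → bob ∉ N.head e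

/-- The min cut from a set `S` of hyperedges to `bob` (every hyperedge has unit capacity). -/
noncomputable def minCut (N : Network V ne) (alice bob : V) (S : Finset (Fin ne)) : ℕ :=
  sInf {k | ∃ C : Finset (Fin ne), N.Separates alice bob S C ∧ C.card = k}

open scoped Classical in
/-- The transmission opportunities of a node. -/
noncomputable def out (N : Network V ne) (v : V) : Finset (Fin ne) :=
  Finset.univ.filter fun e => N.tail e = v

/-- The capacity of the network: the min cut from `alice` to `bob`. -/
noncomputable def capacity (N : Network V ne) (alice bob : V) : ℕ :=
  N.minCut alice bob (N.out alice)

open scoped Classical in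
/-- The packets carried by the hyperedges, when `alice` sends `x e` on her hyperedges, a packet
sent by another node is the linear combination, with coefficients `f`, of the packets received
by that node so far, and `err e` is added to the packet on `e`. -/
noncomputable def packet {F C : Type*} [Field F] (N : Network V ne) (alice : V)
    (x : Fin ne → C → F) (f : Fin ne → Fin ne → F) (err : Fin ne → C → F) (e : Fin ne) : C → F :=
  (if N.tail e = alice then x e
    else ∑ e' : {e' : Fin ne // N.Feeds alice e' e}, f e'.1 e • packet N alice x f err e'.1)
  + err e
termination_by e
decreasing_by exact e'.2.1

open scoped Classical in
/-- The packets received by `bob`, as the rows of a matrix (the row of a hyperedge that does not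
reach `bob` is zero), when the errors `err` are injected into the hyperedges of `A`. -/
noncomputable def received {F C : Type*} [Field F] (N : Network V ne) (alice bob : V)
    (x : Fin ne → C → F) (f : Fin ne → Fin ne → F) (A : Finset (Fin ne))
    (err : Fin ne → C → F) : Matrix (Fin ne) C F :=
  fun e c => if bob ∈ N.head e then
    N.packet alice x f (fun e' => if e' ∈ A then err e' else 0) e c else 0

end Network

/-! ### The code

Stages are numbered from `0`: stage `k` here is the `(k+1)`-st stage, and the data available
after `t` stages are those of the stages `k < t`. -/

/-- Batch size `b`, message length `n`, and the design parameters `σ`, `m` of the short packets. -/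
structure Params where
  b : ℕ
  n : ℕ
  σ : ℕ
  m : ℕ

/-- The message: a `b × n` matrix. -/
abbrev Message (p : Params) (F : Type*) := Matrix (Fin p.b) (Fin p.n) F

/-- The columns of a long packet: `n` message columns, then the `b` identity columns. -/
abbrev LongCol (p : Params) := Fin p.n ⊕ Fin p.b

/-- The front columns of the short packets after `t` stages: `t` blocks of `m` columns. -/
abbrev ShortFront (p : Params) (t : ℕ) := Fin t × Fin p.m

/-- The rear (identity) columns of the short packets after `t` stages: `t` blocks of `σ`. -/
abbrev ShortRear (p : Params) (t : ℕ) := Fin t × Fin p.σ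

/-- The columns of a short packet after `t` stages; their number is `t (m + σ)`. -/
abbrev ShortCol (p : Params) (t : ℕ) := ShortFront p t ⊕ ShortRear p t

/-- The `(k+1) σ m` parity checks of stage `k`, arranged as the positions of
a `σ × (k+1) m` matrix (column first). -/
abbrev ParityIdx (p : Params) (k : ℕ) := ShortFront p (k + 1) × Fin p.σ

/-- The parity checks of all stages. -/
abbrev SecretIdx (p : Params) := Σ k : ℕ, ParityIdx p k

/-- The parity checks of the stages `k < t`. -/
abbrev ParityUpTo (p : Params) (t : ℕ) := Σ k : Fin t, ParityIdx p k

/-- The public random symbols: the entries of Alice's encoding matrices `K` (long packets) and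
`G` (short packets), and the coding coefficients used by the internal nodes. -/
inductive PubCoin (p : Params) (ne : ℕ) where
  | longEnc (k : ℕ) (e : Fin ne) (s : Fin p.b)
  | shortEnc (k : ℕ) (e : Fin ne) (r : ShortRear p (k + 1))
  | longNode (k : ℕ) (e' e : Fin ne)
  | shortNode (k : ℕ) (e' e : Fin ne)

variable {p : Params} {ne : ℕ} {F : Type*} [Field F]

/-- The row of the Vandermonde matrix `D` generated by the symbol `d`, applied to the
column-stacked message: `∑_j d^j w_j`, `j = 1, …, nb`. -/
def hashRow (d : F) (W : Message p F) : F :=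
  ∑ c : Fin p.n, ∑ s : Fin p.b, d ^ ((c : ℕ) * p.b + (s : ℕ) + 1) * W s c

/-- The linearly independent redundancy `l = h - D w`. -/
def parity (W : Message p F) (d h : SecretIdx p → F) : SecretIdx p → F :=
  fun j => h j - hashRow (d j) W

/-- `X₀ = (W I)`. -/
def source (W : Message p F) : Matrix (Fin p.b) (LongCol p) F :=
  Matrix.fromCols W 1

/-- The front part of the stacked matrix `L` after `t` stages: row block `j` is the
`σ × (j+1) m` matrix of the parity symbols of stage `j`, followed by zeros. -/
def shortFrontMatrix (t : ℕ) (l : ParityUpTo p t → F) :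
    Matrix (ShortRear p t) (ShortFront p t) F :=
  fun r c => if hc : (c.1 : ℕ) < (r.1 : ℕ) + 1 then l ⟨r.1, ((⟨c.1, hc⟩, c.2), r.2)⟩ else 0

/-- The parity symbols of the first `t` stages. -/
def upTo (t : ℕ) (l : SecretIdx p → F) : ParityUpTo p t → F :=
  fun j => l ⟨j.1, j.2⟩

/-- The stacked matrix `L` after `t` stages. -/
def shortSource (t : ℕ) (l : SecretIdx p → F) : Matrix (ShortRear p t) (ShortCol p t) F :=
  Matrix.fromCols (shortFrontMatrix t (upTo t l)) 1

/-- What Calvin does in stage `k`: the hyperedges he attacks and the errors he adds there, for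
the long and for the short packets. -/
structure Attack (p : Params) (ne : ℕ) (F : Type*) (k : ℕ) where
  longSet : Finset (Fin ne)
  longErr : Fin ne → LongCol p → F
  shortSet : Finset (Fin ne)
  shortErr : Fin ne → ShortCol p (k + 1) → F

instance {k : ℕ} : MeasurableSpace (Attack p ne F k) := ⊤

/-- The long packets received by Bob in stage `k`: Alice sends the rows of `K X₀`. -/
noncomputable def longStage {V : Type*} (alice bob : V) (N : Network V ne) (W : Message p F)
    (pub : PubCoin p ne → F) (k : ℕ) (a : Attack p ne F k) : Matrix (Fin ne) (LongCol p) F :=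
  N.received alice bob
    ((Matrix.of fun e s => pub (.longEnc k e s) : Matrix (Fin ne) (Fin p.b) F) * source W)
    (fun e' e => pub (.longNode k e' e)) a.longSet a.longErr

/-- The short packets received by Bob in stage `k`: Alice sends the rows of `G L`. -/
noncomputable def shortStage {V : Type*} (alice bob : V) (N : Network V ne)
    (l : SecretIdx p → F) (pub : PubCoin p ne → F) (k : ℕ) (a : Attack p ne F k) :
    Matrix (Fin ne) (ShortCol p (k + 1)) F :=
  N.received alice bob
    ((Matrix.of fun e r => pub (.shortEnc k e r) :
      Matrix (Fin ne) (ShortRear p (k + 1)) F) * shortSource (k + 1) l)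
    (fun e' e => pub (.shortNode k e' e)) a.shortSet a.shortErr

/-- The stacked matrix of the long packets received in the first `t` stages. -/
def stackLong (t : ℕ) (Y : ℕ → Matrix (Fin ne) (LongCol p) F) :
    Matrix (Fin t × Fin ne) (LongCol p) F :=
  fun r c => Y r.1 r.2 c

/-- The stacked matrix of the short packets received in the first `t` stages, each padded with
zeros to the width `t (m + σ)` in the way the front and the rear columns are aligned. -/
def stackShort (t : ℕ) (J : ∀ k : ℕ, Matrix (Fin ne) (ShortCol p (k + 1)) F) :
    Matrix (Fin t × Fin ne) (ShortCol p t) F :=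
  fun r c => match c with
  | .inl (c, u) => if hc : (c : ℕ) < (r.1 : ℕ) + 1 then J r.1 r.2 (.inl (⟨c, hc⟩, u)) else 0
  | .inr (c, u) => if hc : (c : ℕ) < (r.1 : ℕ) + 1 then J r.1 r.2 (.inr (⟨c, hc⟩, u)) else 0

/-- Bob's expansion of a received matrix: he selects `rank Y` linearly independent rows and
a basis of the column space that consists of `a` front columns (`T''`) and of all rear columns
(`T̂`), and expands the front columns in it, `front = T'' FZ + T̂ FX`. -/
structure Reduction {R α β : Type*} [Fintype α] [Fintype β] (Y : Matrix R (α ⊕ β) F) where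
  a : ℕ
  rank_eq : a + Fintype.card β = Y.rank
  row : Fin Y.rank → R
  row_indep : LinearIndependent F fun i => Y (row i)
  col : Fin a → α
  col_indep : LinearIndependent F fun (v : Fin a ⊕ β) (i : Fin Y.rank) =>
    Y (row i) (Sum.map col id v)
  FZ : Matrix (Fin a) α F
  FX : Matrix β α F
  expand : Y.submatrix row Sum.inl =
    Y.submatrix row (Sum.inl ∘ col) * FZ + Y.submatrix row Sum.inr * FX

/-- `T̂`: the rear columns of the selected rows. -/
def Reduction.That {R α β : Type*} [Fintype α] [Fintype β] {Y : Matrix R (α ⊕ β) F}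
    (ρ : Reduction Y) : Matrix (Fin Y.rank) β F :=
  Y.submatrix ρ.row Sum.inr

/-- The equation `T̂ U_b - T̂ U_a FZ = T̂ FX` for the unknown front part `U` of the source matrix
`(U I)`, where `U_a` consists of the columns of `U` in the basis. All columns of `U` may
stand for `U_b`, because for a basis column the equation is trivial. Written
column by column, this is the block system with the blocks `-f^Z_{u,v} T̂` and `T̂`. -/
def Reduction.Match {R α β : Type*} [Fintype α] [Fintype β] {Y : Matrix R (α ⊕ β) F}
    (ρ : Reduction Y) (U : Matrix β α F) : Prop :=
  ρ.That * U - ρ.That * U.submatrix id ρ.col * ρ.FZ = ρ.That * ρ.FX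

/-- The solutions of Bob's decoding equations after `t` stages: the unknowns are the message and
the parity symbols of the first `t` stages; the three conditions are the equations of
the long packets, of the short packets, and the parity checks `D w + l = h`. -/
def solutions {t : ℕ} {Y : Matrix (Fin t × Fin ne) (LongCol p) F}
    {J : Matrix (Fin t × Fin ne) (ShortCol p t) F} (ρ : Reduction Y) (ρ' : Reduction J)
    (d h : SecretIdx p → F) : Set (Message p F × (ParityUpTo p t → F)) :=
  {x | ρ.Match x.1 ∧ ρ'.Match (shortFrontMatrix t x.2) ∧
    ∀ j : ParityUpTo p t, hashRow (upTo t d j) x.1 + x.2 j = upTo t h j}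

/-- Bob's way of choosing rows and column bases, whenever such a choice exists. -/
structure BasisRule (p : Params) (ne : ℕ) (F : Type*) [Field F] where
  long : ∀ (t : ℕ) (Y : Matrix (Fin t × Fin ne) (LongCol p) F),
    Nonempty (Reduction Y) → Reduction Y
  short : ∀ (t : ℕ) (J : Matrix (Fin t × Fin ne) (ShortCol p t) F),
    Nonempty (Reduction J) → Reduction J

/-- The result of an attempt to decode. -/
inductive Outcome (p : Params) (F : Type*) where
  | wait
  | decoded (W : Message p F)
  | failure

open scoped Classical in
/-- Bob's decoder after `t` stages: he waits if the required bases do not exist or the decoding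
equations have no solution, decodes if there is exactly one solution, and declares
a failure if there are several. -/
noncomputable def decode (B : BasisRule p ne F) (t : ℕ)
    (Y : Matrix (Fin t × Fin ne) (LongCol p) F) (J : Matrix (Fin t × Fin ne) (ShortCol p t) F)
    (d h : SecretIdx p → F) : Outcome p F :=
  if hb : Nonempty (Reduction Y) ∧ Nonempty (Reduction J) then
    if solutions (B.long t Y hb.1) (B.short t J hb.2) d h = ∅ then .wait
    else if hs : ∃ x, solutions (B.long t Y hb.1) (B.short t J hb.2) d h = {x} then
      .decoded hs.choose.1
    else .failure
  else .wait

/-! ### A session in a random environment -/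

/-- The uncontrolled randomness: in every stage, the network used for the long packets, the one
used for the short packets, and the min cuts that Calvin has to Bob in them. -/
structure Environment (Ω V : Type*) (ne : ℕ) where
  alice : V
  bob : V
  longNet : ℕ → Ω → Network V ne
  shortNet : ℕ → Ω → Network V ne
  z : ℕ → Ω → ℕ
  zbar : ℕ → Ω → ℕ

namespace Environment

variable {Ω V : Type*} (S : Environment Ω V ne)

/-- The capacity for the long packets in stage `k`. -/
noncomputable def M (k : ℕ) (ω : Ω) : ℕ := (S.longNet k ω).capacity S.alice S.bob

/-- The capacity for the short packets in stage `k`. -/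
noncomputable def Mbar (k : ℕ) (ω : Ω) : ℕ := (S.shortNet k ω).capacity S.alice S.bob

/-- The first number `t` of stages with `b + ∑_{k<t} z_k ≤ ∑_{k<t} M_k` (and `0` if there
is none). -/
noncomputable def cutTime (b : ℕ) (ω : Ω) : ℕ :=
  sInf {t | b + ∑ k ∈ Finset.range t, S.z k ω ≤ ∑ k ∈ Finset.range t, S.M k ω}

/-- Calvin's strategy. He knows the message (the strategy may be chosen in view of it), the
environment, all encoding and coding coefficients and all symbols `l` that Alice sends, even those
of later stages, but not the shared secrets `d` and `h`. In stage `k`, the min cut to Bob from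
the hyperedges that he attacks is at most `z k` (long packets) or `zbar k` (short packets). -/
structure Calvin [MeasurableSpace Ω] (p : Params) (F : Type*) [MeasurableSpace F] where
  act : ∀ k : ℕ, Ω × (PubCoin p ne → F) × (SecretIdx p → F) → Attack p ne F k
  measurable_act : ∀ k, Measurable (act k)
  long_le : ∀ k x, (S.longNet k x.1).minCut S.alice S.bob (act k x).longSet ≤ S.z k x.1
  short_le : ∀ k x, (S.shortNet k x.1).minCut S.alice S.bob (act k x).shortSet ≤ S.zbar k x.1

/-- A sample point: the environment, the public random symbols, the secrets `d` and `h`. -/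
abbrev Sample (Ω : Type*) (p : Params) (ne : ℕ) (F : Type*) :=
  Ω × (PubCoin p ne → F) × (SecretIdx p → F) × (SecretIdx p → F)

/-- The law of a session: all random symbols are independent of the environment, mutually
independent, and uniform on `F`. -/
noncomputable def law [MeasurableSpace Ω] (μ : Measure Ω) (p : Params) (ne : ℕ) (F : Type*)
    [Field F] [Fintype F] [MeasurableSpace F] : Measure (Sample Ω p ne F) :=
  μ.prod
    ((Measure.infinitePi fun _ : PubCoin p ne => (PMF.uniformOfFintype F).toMeasure).prod
      ((Measure.infinitePi fun _ : SecretIdx p => (PMF.uniformOfFintype F).toMeasure).prod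
        (Measure.infinitePi fun _ : SecretIdx p => (PMF.uniformOfFintype F).toMeasure)))

variable [MeasurableSpace Ω] [MeasurableSpace F] (B : BasisRule p ne F) (W : Message p F)
  (A : S.Calvin p F)

/-- What Calvin does in stage `k`. -/
def attack (x : Sample Ω p ne F) (k : ℕ) : Attack p ne F k :=
  A.act k (x.1, x.2.1, parity W x.2.2.1 x.2.2.2)

/-- The result of Bob's attempt to decode after `t` stages. -/
noncomputable def outcome (x : Sample Ω p ne F) (t : ℕ) : Outcome p F :=
  decode B t
    (stackLong t fun k =>
      longStage S.alice S.bob (S.longNet k x.1) W x.2.1 k (S.attack W A x k))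
    (stackShort t fun k =>
      shortStage S.alice S.bob (S.shortNet k x.1) (parity W x.2.2.1 x.2.2.2) x.2.1 k
        (S.attack W A x k))
    x.2.2.1 x.2.2.2

/-- The number of stages after which Bob stops waiting (and `0` if he waits forever). -/
noncomputable def stopTime (x : Sample Ω p ne F) : ℕ :=
  sInf {t | S.outcome B W A x t ≠ .wait}

/-- Bob's first attempt that does not make him wait yields the message that was sent. -/
def Correct (x : Sample Ω p ne F) : Prop :=
  S.outcome B W A x (S.stopTime B W A x) = .decoded W

open scoped Classical in
/-- The rate of a session, in message packets per stage: `b` divided by the number of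
stages if Bob decodes correctly, and `0` otherwise. -/
noncomputable def sessionRate (x : Sample Ω p ne F) : ℝ :=
  if S.Correct B W A x then (p.b : ℝ) / S.stopTime B W A x else 0

end Environment

end RatelessCode

namespace RatelessCode

/-! ### A random walk with bounded steps and its passage time -/

/-! The passage time. Put X_k = M_k - z_k. These are i.i.d. steps between 0 and `cbar` with positive
mean, and N is the first time at which their walk reaches b. The event N > k depends only on the
steps before step k, so Wald's argument, truncated at t, gives E[X] E[min(N,t)] ≤ b - 1 + cbar: the
walk is at most b - 1 before the crossing step, which adds at most cbar. Hence P(N > t) = O(1/t), so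
N is almost surely finite, and Jensen's inequality for 1/x gives the rate bound
(`rate_le_integral_passageTime`).

The true message is a solution. Bob receives Y = T X₀ + E, where the columns of E lie in the span of
the transfer vectors of the attacked hyperedges. That span has dimension at most the min cut of the
attacked set (`Network.finrank_transferSpan_le`). For coding coefficients without algebraic
coincidences, the rank of Alice's transfer vectors is at least her min cut
(`Network.Generic.minCut_le_finrank`), and her random combinations keep T injective modulo the error
space once b + ∑ z ≤ ∑ M (`longTransfer_injective_mod`). Any column relation of Y then holds for the
source as well (`Reduction.match_of_injective_mod`), so Bob's bases exist and the truth solves his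
equations. For short packets the same works stage by stage, because their transfer matrix is block
triangular.

There is no other solution. Each of the two matrix equations determines its unknown from the front
basis columns, and there are at most dim(error space) of these, so the number of candidates is a
bounded power of q. Since l = h - Dw and h is uniform, the secrets d are independent of everything
that Calvin knows and hence of what Bob receives. For a fixed wrong message every parity check is a
nonzero polynomial equation of degree at most nb in its own symbol of d. There is at least one check
more than the exponent of q in the candidate count, so the union bound is O(1/q)
(`uniformSymbols_false_solution_le`).

Order of choices. First a horizon T is fixed from the walk alone. Then the finitely many
coincidences and false-solution events up to T are bounded by a constant over q, and q is taken
large. -/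

theorem sum_step_below_le (x : ℕ → ℕ) {b c : ℕ} (hb : 1 ≤ b) (hx : ∀ k, x k ≤ c) (t : ℕ) :
    ∑ k ∈ Finset.range t, (if ∑ j ∈ Finset.range k, x j < b then x k else 0) ≤ b - 1 + c := by
  -- The induction also needs that nothing has been cut off while the walk is still below b.
  suffices h : ∑ k ∈ Finset.range t, (if ∑ j ∈ Finset.range k, x j < b then x k else 0)
        ≤ b - 1 + c ∧ (∑ j ∈ Finset.range t, x j < b →
      ∑ k ∈ Finset.range t, (if ∑ j ∈ Finset.range k, x j < b then x k else 0)
        = ∑ j ∈ Finset.range t, x j) from h.1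
  induction t with
  | zero => simp
  | succ t ih =>
    have := hx t
    simp only [Finset.sum_range_succ]
    split_ifs with h
    · have := ih.2 h
      omega
    · exact ⟨by simpa using ih.1, fun h' => by omega⟩

section Walk

variable {Ω : Type*} [MeasurableSpace Ω] {μ : Measure Ω} [IsProbabilityMeasure μ]

theorem integrable_natCast_of_le {X : Ω → ℕ} (hX : Measurable X) {c : ℕ} (hc : ∀ ω, X ω ≤ c) :
    Integrable (fun ω => (X ω : ℝ)) μ :=
  Integrable.of_bound (C := c) (by fun_prop) <| ae_of_all _ fun ω => by
    simpa using hc ω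

/-- Wald's identity truncated at t: whether the walk is below b at time k depends only on earlier
steps, so the indicator is independent of X_k. Summing the products and using the pathwise overshoot
bound gives the claim. The sum of probabilities is E[min(N,t)]. -/
theorem integral_mul_sum_measureReal_le {X : ℕ → Ω → ℕ} (hX : ∀ k, Measurable (X k)) {b c : ℕ}
    (hb : 1 ≤ b) (hc : ∀ k ω, X k ω ≤ c) (hindep : iIndepFun X μ)
    (hident : ∀ k, IdentDistrib (X k) (X 0) μ μ) (t : ℕ) :
    (∫ ω, (X 0 ω : ℝ) ∂μ) *
      ∑ k ∈ Finset.range t, μ.real {ω | ∑ j ∈ Finset.range k, X j ω < b} ≤ (b : ℝ) - 1 + c := by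
  have hS : ∀ k, Measurable fun ω => ∑ j ∈ Finset.range k, X j ω := fun k =>
    Finset.measurable_sum _ fun j _ => hX j
  have hI : ∀ k, Measurable fun ω => if ∑ j ∈ Finset.range k, X j ω < b then (1 : ℝ) else 0 :=
    fun k => (Measurable.of_discrete (f := fun s : ℕ => if s < b then (1 : ℝ) else 0)).comp (hS k)
  have key : ∀ k, ∫ ω, (if ∑ j ∈ Finset.range k, X j ω < b then (1 : ℝ) else 0) * (X k ω : ℝ) ∂μ
      = μ.real {ω | ∑ j ∈ Finset.range k, X j ω < b} * ∫ ω, (X 0 ω : ℝ) ∂μ := by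
    intro k
    have h1 : IndepFun (fun ω => if ∑ j ∈ Finset.range k, X j ω < b then (1 : ℝ) else 0)
        (fun ω => (X k ω : ℝ)) μ := by
      have := (hindep.indepFun_finsetSum_of_notMem hX (s := Finset.range k) (i := k) (by simp)).comp
        (φ := fun s : ℕ => if s < b then (1 : ℝ) else 0) (ψ := fun s : ℕ => (s : ℝ))
        Measurable.of_discrete Measurable.of_discrete
      convert this using 2 <;> simp
    rw [h1.integral_fun_mul_eq_mul_integral (hI k).aestronglyMeasurable
      (by have := hX k; fun_prop)]
    congr 1
    · have : (fun ω => if ∑ j ∈ Finset.range k, X j ω < b then (1 : ℝ) else 0)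
          = Set.indicator {ω | ∑ j ∈ Finset.range k, X j ω < b} (fun _ => (1 : ℝ)) := by
        ext ω; simp [Set.indicator_apply]
      rw [this, integral_indicator_const _
        (show MeasurableSet {ω | ∑ j ∈ Finset.range k, X j ω < b} from
          (hS k) (measurableSet_Iio (a := b)))]
      simp
    · exact ((hident k).comp (u := fun s : ℕ => (s : ℝ)) Measurable.of_discrete).integral_eq
  have hint : ∀ k, Integrable
      (fun ω => (if ∑ j ∈ Finset.range k, X j ω < b then (1 : ℝ) else 0) * (X k ω : ℝ)) μ := by
    intro k
    refine Integrable.of_bound (C := c)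
      ((hI k).aestronglyMeasurable.mul (by have := hX k; fun_prop)) <| ae_of_all _ fun ω => ?_
    have := hc k ω
    split_ifs <;> simp [this]
  rw [mul_comm, Finset.sum_mul]
  simp_rw [← key]
  rw [← integral_finsetSum _ fun k _ => hint k]
  have hle : ∀ ω, ∑ k ∈ Finset.range t,
      (if ∑ j ∈ Finset.range k, X j ω < b then (1 : ℝ) else 0) * (X k ω : ℝ)
        ≤ (b : ℝ) - 1 + c := by
    intro ω
    have h := sum_step_below_le (fun k => X k ω) hb (fun k => hc k ω) t
    have h' : ((∑ k ∈ Finset.range t,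
      (if ∑ j ∈ Finset.range k, X j ω < b then X k ω else 0) : ℕ) : ℝ) ≤ ((b - 1 + c : ℕ) : ℝ) :=
      Nat.cast_le.2 h
    push_cast [hb] at h'
    refine le_trans (le_of_eq (Finset.sum_congr rfl fun k _ => ?_)) h'
    split_ifs <;> simp
  calc _ ≤ ∫ _, ((b : ℝ) - 1 + c) ∂μ :=
        integral_mono (integrable_finsetSum _ fun k _ => hint k) (integrable_const _) hle
    _ = _ := by simp

/-- The chance that the walk has not reached `b` after `t` steps is `O(1 / t)`. -/
theorem measureReal_walk_lt_le {X : ℕ → Ω → ℕ} (hX : ∀ k, Measurable (X k)) {b c : ℕ}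
    (hb : 1 ≤ b) (hc : ∀ k ω, X k ω ≤ c) (hindep : iIndepFun X μ)
    (hident : ∀ k, IdentDistrib (X k) (X 0) μ μ) (hpos : 0 < ∫ ω, (X 0 ω : ℝ) ∂μ) {t : ℕ}
    (ht : 0 < t) :
    μ.real {ω | ∑ j ∈ Finset.range t, X j ω < b}
      ≤ (((b : ℝ) - 1 + c) / ∫ ω, (X 0 ω : ℝ) ∂μ) / t := by
  rw [le_div_iff₀ (by positivity), le_div_iff₀ hpos, mul_comm]
  refine le_trans (mul_le_mul_of_nonneg_left ?_ hpos.le)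
    (integral_mul_sum_measureReal_le hX hb hc hindep hident t)
  calc μ.real {ω | ∑ j ∈ Finset.range t, X j ω < b} * t
      = ∑ _k ∈ Finset.range t, μ.real {ω | ∑ j ∈ Finset.range t, X j ω < b} := by
        simp [mul_comm]
    _ ≤ _ := by
        -- The partial sums are nondecreasing, so being below b at time t implies being below b at
        -- every k < t.
        refine Finset.sum_le_sum fun k hk => measureReal_mono fun ω (hω : _ < b) => ?_
        exact lt_of_le_of_lt (Finset.sum_le_sum_of_subset
          (Finset.range_subset_range.2 (Finset.mem_range.1 hk).le)) hω

theorem exists_measureReal_walk_lt_le {X : ℕ → Ω → ℕ} (hX : ∀ k, Measurable (X k)) {b c : ℕ}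
    (hb : 1 ≤ b) (hc : ∀ k ω, X k ω ≤ c) (hindep : iIndepFun X μ)
    (hident : ∀ k, IdentDistrib (X k) (X 0) μ μ) (hpos : 0 < ∫ ω, (X 0 ω : ℝ) ∂μ) {η : ℝ}
    (hη : 0 < η) : ∃ t : ℕ, μ.real {ω | ∑ j ∈ Finset.range t, X j ω < b} ≤ η := by
  have h := tendsto_const_div_atTop_nhds_zero_nat (((b : ℝ) - 1 + c) / ∫ ω, (X 0 ω : ℝ) ∂μ)
  obtain ⟨t, ht, ht0⟩ := ((h.eventually (gt_mem_nhds hη)).and (eventually_gt_atTop 0)).exists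
  exact ⟨t, (measureReal_walk_lt_le hX hb hc hindep hident hpos ht0).trans ht.le⟩

theorem ae_exists_le_walk {X : ℕ → Ω → ℕ} (hX : ∀ k, Measurable (X k)) {b c : ℕ}
    (hb : 1 ≤ b) (hc : ∀ k ω, X k ω ≤ c) (hindep : iIndepFun X μ)
    (hident : ∀ k, IdentDistrib (X k) (X 0) μ μ) (hpos : 0 < ∫ ω, (X 0 ω : ℝ) ∂μ) :
    ∀ᵐ ω ∂μ, ∃ t : ℕ, b ≤ ∑ j ∈ Finset.range t, X j ω := by
  have h0 : μ.real {ω | ¬ ∃ t : ℕ, b ≤ ∑ j ∈ Finset.range t, X j ω} ≤ 0 := by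
    refine le_of_forall_pos_le_add fun η hη => ?_
    obtain ⟨t, ht⟩ := exists_measureReal_walk_lt_le hX hb hc hindep hident hpos hη
    refine le_trans (measureReal_mono fun ω hω => ?_) (ht.trans (by simp))
    exact not_le.1 fun h => hω ⟨t, h⟩
  exact (measureReal_eq_zero_iff (measure_ne_top _ _)).1 (le_antisymm h0 measureReal_nonneg)

/-- The first time at which the walk with the steps `x` is at least `b` (and `0` if there is
none). -/
noncomputable def passageTime (b : ℕ) (x : ℕ → ℕ) : ℕ :=
  sInf {t | b ≤ ∑ j ∈ Finset.range t, x j}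

/-- Monotonicity of the partial sums turns a first passage into a threshold condition. Existence of
a passage is needed because the infimum of the empty set is 0. -/
theorem lt_passageTime_iff {b : ℕ} {x : ℕ → ℕ} (h : ∃ t, b ≤ ∑ j ∈ Finset.range t, x j) (k : ℕ) :
    k < passageTime b x ↔ ∑ j ∈ Finset.range k, x j < b := by
  constructor
  · intro hk
    exact not_le.1 fun h' => absurd hk (not_lt.2 (Nat.sInf_le h'))
  · intro hk
    by_contra! hle
    have h1 : b ≤ ∑ j ∈ Finset.range (passageTime b x), x j := Nat.sInf_mem h
    have := Finset.sum_le_sum_of_subset (f := x) (Finset.range_subset_range.2 hle)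
    omega

theorem measurable_passageTime {X : ℕ → Ω → ℕ} (hX : ∀ k, Measurable (X k)) (b : ℕ) :
    Measurable fun ω => passageTime b fun k => X k ω := by
  have hm : ∀ n, MeasurableSet {ω | b ≤ ∑ j ∈ Finset.range n, X j ω} := fun n =>
    (Finset.measurable_sum (Finset.range n) fun j _ => hX j) (measurableSet_Ici (a := b))
  refine measurable_to_countable' fun n => ?_
  -- The value 0 also collects the paths that never reach b, hence the extra set for n = 0.
  have : (fun ω => passageTime b fun k => X k ω) ⁻¹' {n} =
      ({ω | b ≤ ∑ j ∈ Finset.range n, X j ω} ∩ ⋂ k < n, {ω | b ≤ ∑ j ∈ Finset.range k, X j ω}ᶜ) ∪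
        (if n = 0 then ⋂ k, {ω | b ≤ ∑ j ∈ Finset.range k, X j ω}ᶜ else ∅) := by
    ext ω
    by_cases he : ∃ t, b ≤ ∑ j ∈ Finset.range t, X j ω
    · have h1 : b ≤ ∑ j ∈ Finset.range (passageTime b fun k => X k ω), X j ω := Nat.sInf_mem he
      have h2 := lt_passageTime_iff (x := fun k => X k ω) he
      have h3 : ω ∉ (if n = 0 then ⋂ k, {ω | b ≤ ∑ j ∈ Finset.range k, X j ω}ᶜ else ∅) := by
        split_ifs
        · simpa using he
        · simp
      simp only [Set.mem_preimage, Set.mem_singleton_iff, Set.mem_union, h3, or_false,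
        Set.mem_inter_iff, Set.mem_ofPred_eq, Set.mem_iInter, Set.mem_compl_iff, not_le]
      constructor
      · rintro rfl
        exact ⟨h1, fun k hk => (h2 k).1 hk⟩
      · rintro ⟨h4, h5⟩
        refine le_antisymm (not_lt.1 fun h => ?_) (not_lt.1 fun h => ?_)
        · have := (h2 n).1 h
          omega
        · have := h5 _ h
          omega
    · have h1 : (passageTime b fun k => X k ω) = 0 := by
        exact Nat.sInf_eq_zero.2 (Or.inr (Set.eq_empty_of_forall_notMem fun t ht => he ⟨t, ht⟩))
      push Not at he
      rcases eq_or_ne n 0 with rfl | hn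
      · simp [h1, he]
      · simp [h1, hn, hn.symm, he]
  rw [this]
  refine ((hm n).inter (MeasurableSet.biInter (Set.to_countable _) fun k _ => (hm k).compl)).union ?_
  split_ifs
  · exact MeasurableSet.iInter fun k => (hm k).compl
  · exact MeasurableSet.empty

/-- Jensen's inequality E[1/N] ≥ 1/E[N] combined with Wald's bound for E[N]. The convexity is used
through one tangent line at the truncated time min(N,t), followed by t → ∞, so integrability of N
never has to be discussed. -/
theorem rate_le_integral_passageTime {X : ℕ → Ω → ℕ} (hX : ∀ k, Measurable (X k)) {b c : ℕ}
    (hb : 1 ≤ b) (hc : ∀ k ω, X k ω ≤ c) (hindep : iIndepFun X μ)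
    (hident : ∀ k, IdentDistrib (X k) (X 0) μ μ) (hpos : 0 < ∫ ω, (X 0 ω : ℝ) ∂μ) :
    (b : ℝ) / ((b : ℝ) + c - 1) * (∫ ω, (X 0 ω : ℝ) ∂μ)
      ≤ ∫ ω, (b : ℝ) / (passageTime b fun k => X k ω : ℕ) ∂μ := by
  set mean := ∫ ω, (X 0 ω : ℝ) ∂μ with hmean
  have hb' : (1 : ℝ) ≤ b := by exact_mod_cast hb
  have hc0 : 0 < (c : ℝ) := by
    -- A positive mean forces c > 0; this keeps b - 1 + c positive even for b = 1.
    rcases Nat.eq_zero_or_pos c with rfl | h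
    · have : mean = 0 := by
        rw [hmean]
        simp [fun ω => Nat.le_zero.1 (hc 0 ω)]
      linarith
    · exact_mod_cast h
  have hD : 0 < (b : ℝ) - 1 + c := by linarith
  -- The reciprocal of Wald's upper bound for E[N]; the tangent to 1/x is taken at x = 1/a.
  set a := mean / ((b : ℝ) - 1 + c) with ha
  have ha0 : 0 < a := by positivity
  have hN := measurable_passageTime hX b
  have hS : ∀ k, MeasurableSet {ω | ∑ j ∈ Finset.range k, X j ω < b} := fun k =>
    (Finset.measurable_sum (Finset.range k) fun j _ => hX j) (measurableSet_Iio (a := b))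
  have hNint : Integrable (fun ω => (1 : ℝ) / (passageTime b fun k => X k ω : ℕ)) μ := by
    refine Integrable.of_bound (C := 1) (Measurable.aestronglyMeasurable <|
      (Measurable.of_discrete (f := fun s : ℕ => (1 : ℝ) / s)).comp hN) <| ae_of_all _ fun ω => ?_
    rcases Nat.eq_zero_or_pos (passageTime b fun k => X k ω) with h | h
    · simp [h]
    · have : (1 : ℝ) ≤ (passageTime b fun k => X k ω : ℕ) := by exact_mod_cast h
      rw [Real.norm_of_nonneg (by positivity)]
      exact div_le_one_of_le₀ this (by positivity)
  have main : ∀ t : ℕ, 0 < t →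
      a ≤ ∫ ω, (1 : ℝ) / (passageTime b fun k => X k ω : ℕ) ∂μ + 1 / t := by
    intro t ht
    have hIint : ∀ k, Integrable
        (Set.indicator {ω | ∑ j ∈ Finset.range k, X j ω < b} fun _ => (1 : ℝ)) μ := fun k =>
      (integrable_const _).indicator (hS k)
    have h1 : ∀ᵐ ω ∂μ, 2 * a - a ^ 2 * ∑ k ∈ Finset.range t,
        Set.indicator {ω | ∑ j ∈ Finset.range k, X j ω < b} (fun _ => (1 : ℝ)) ω
          ≤ (1 : ℝ) / (passageTime b fun k => X k ω : ℕ) + 1 / t := by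
      filter_upwards [ae_exists_le_walk hX hb hc hindep hident hpos] with ω hω
      have h2 := lt_passageTime_iff (x := fun k => X k ω) hω
      have hN0 : 0 < passageTime b fun k => X k ω := (h2 0).2 (by simpa using Nat.lt_of_lt_of_le one_pos hb)
      set N := passageTime b fun k => X k ω
      have h3 : ∑ k ∈ Finset.range t,
          Set.indicator {ω | ∑ j ∈ Finset.range k, X j ω < b} (fun _ => (1 : ℝ)) ω
            = ((min N t : ℕ) : ℝ) := by
        simp only [Set.indicator_apply, Set.mem_ofPred_eq, ← h2]
        rw [Finset.sum_boole]
        congr 1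
        rw [show (Finset.range t).filter (fun k => k < N) = Finset.range (min N t) by
          ext k; simp [and_comm], Finset.card_range]
      rw [h3]
      have hm0 : 0 < ((min N t : ℕ) : ℝ) := by exact_mod_cast lt_min hN0 ht
      -- The tangent line lies below 1/x, which is (ax - 1)² ≥ 0.
      have h4 : 2 * a - a ^ 2 * ((min N t : ℕ) : ℝ) ≤ 1 / ((min N t : ℕ) : ℝ) := by
        rw [le_div_iff₀ hm0]
        nlinarith [sq_nonneg (a * ((min N t : ℕ) : ℝ) - 1)]
      refine h4.trans ?_
      rcases le_total N t with h | h
      · rw [min_eq_left h]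
        simp
      · rw [min_eq_right h]
        simp
    have h5 := integral_mono_ae
      ((integrable_const _).sub ((integrable_finsetSum _ fun k _ => hIint k).const_mul _))
      (hNint.add (integrable_const _)) h1
    rw [integral_sub' (integrable_const _)
      ((integrable_finsetSum _ fun k _ => hIint k).const_mul _), integral_const_mul (a ^ 2),
      integral_finsetSum _ fun k _ => hIint k, integral_add' hNint (integrable_const _)] at h5
    simp only [integral_const, probReal_univ, smul_eq_mul, one_mul,
      integral_indicator_const _ (hS _), mul_one] at h5
    have h6 := integral_mul_sum_measureReal_le hX hb hc hindep hident t
    have h7 : a ^ 2 * ∑ k ∈ Finset.range t, μ.real {ω | ∑ j ∈ Finset.range k, X j ω < b} ≤ a := by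
      have : a ^ 2 * ∑ k ∈ Finset.range t, μ.real {ω | ∑ j ∈ Finset.range k, X j ω < b}
          = a * ((mean * ∑ k ∈ Finset.range t, μ.real {ω | ∑ j ∈ Finset.range k, X j ω < b})
            / ((b : ℝ) - 1 + c)) := by
        rw [ha]; ring
      rw [this]
      exact mul_le_of_le_one_right ha0.le ((div_le_one₀ hD).2 h6)
    linarith
  have hlim : a ≤ ∫ ω, (1 : ℝ) / (passageTime b fun k => X k ω : ℕ) ∂μ := by
    have h := (tendsto_const_nhds (x := ∫ ω, (1 : ℝ) / (passageTime b fun k => X k ω : ℕ) ∂μ)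
      (f := atTop)).add (tendsto_const_div_atTop_nhds_zero_nat (1 : ℝ))
    rw [add_zero] at h
    exact ge_of_tendsto h ((eventually_gt_atTop 0).mono main)
  have h8 : ∫ ω, (b : ℝ) / (passageTime b fun k => X k ω : ℕ) ∂μ
      = b * ∫ ω, (1 : ℝ) / (passageTime b fun k => X k ω : ℕ) ∂μ := by
    rw [← integral_const_mul]
    simp [div_eq_mul_inv]
  rw [h8]
  calc _ = (b : ℝ) * a := by rw [ha, sub_add_eq_add_sub]; ring
    _ ≤ _ := by gcongr

/-- An overhead that does not grow with the message length `n` is negligible as `n → ∞`. -/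
theorem tendsto_integral_rate_with_overhead {N : Ω → ℕ} (hN : Measurable N) (b s : ℕ) :
    Tendsto (fun n : ℕ => ∫ ω, ((b : ℝ) * n) /
        (∑ k ∈ Finset.range (N ω), (((n : ℝ) + b) + ((k : ℝ) + 1) * s)) ∂μ)
      atTop (𝓝 (∫ ω, (b : ℝ) / N ω ∂μ)) := by
  -- The constant b dominates: if N > 0, the first summand of the denominator is already at least n,
  -- and if N = 0 the quotient is 0.
  refine tendsto_integral_of_dominated_convergence (fun _ => (b : ℝ)) (fun n => ?_)
    (integrable_const _) (fun n => ae_of_all _ fun ω => ?_) (ae_of_all _ fun ω => ?_)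
  · exact ((Measurable.of_discrete (f := fun N : ℕ => ((b : ℝ) * n) /
        (∑ k ∈ Finset.range N, (((n : ℝ) + b) + ((k : ℝ) + 1) * s)))).comp hN).aestronglyMeasurable
  · rw [Real.norm_of_nonneg (by positivity)]
    rcases Nat.eq_zero_or_pos (N ω) with h | h
    · simp [h]
    · refine div_le_of_le_mul₀ (by positivity) (by positivity)
        (mul_le_mul_of_nonneg_left ?_ (by positivity))
      calc (n : ℝ) ≤ n + b + ((0 : ℕ) + 1) * s := by
            have : 0 ≤ (b : ℝ) := by positivity
            have : 0 ≤ (s : ℝ) := by positivity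
            push_cast; linarith
        _ ≤ _ := Finset.single_le_sum (f := fun k : ℕ => ((n : ℝ) + b) + ((k : ℝ) + 1) * s)
            (fun k _ => by positivity) (Finset.mem_range.2 h)
  -- For a fixed path the denominator is N n + C with C independent of n.
  · set C := ∑ k ∈ Finset.range (N ω), ((b : ℝ) + ((k : ℝ) + 1) * s) with hC
    have h1 : ∀ n : ℕ, ((b : ℝ) * n) /
        (∑ k ∈ Finset.range (N ω), (((n : ℝ) + b) + ((k : ℝ) + 1) * s))
          = (b : ℝ) * n / (N ω * n + C) := by
      intro n
      congr 1
      simp only [hC, add_assoc, Finset.sum_add_distrib, Finset.sum_const, Finset.card_range,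
        nsmul_eq_mul]
    simp only [h1]
    rcases Nat.eq_zero_or_pos (N ω) with h | h
    · simp [hC, h]
    · have hN0 : (N ω : ℝ) ≠ 0 := by positivity
      have h2 : Tendsto (fun n : ℕ => (b : ℝ) / (N ω + C / n)) atTop (𝓝 (b / (N ω + 0))) :=
        (tendsto_const_nhds).div (tendsto_const_nhds.add (tendsto_const_div_atTop_nhds_zero_nat C))
          (by simpa using hN0)
      rw [add_zero] at h2
      refine h2.congr' ((eventually_gt_atTop 0).mono fun n hn => ?_)
      have : (n : ℝ) ≠ 0 := by positivity
      field_simp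

end Walk

/-! ### Independent uniform symbols -/

theorem measurable_update_uncurry {ι F : Type*} [MeasurableSpace F] [DecidableEq ι] (i : ι) :
    Measurable fun p : F × (ι → F) => Function.update p.2 i p.1 := by
  refine measurable_pi_iff.2 fun j => ?_
  rcases eq_or_ne j i with rfl | h
  · simpa using measurable_fst
  · simpa [h, Function.comp_def] using (measurable_pi_apply j).comp measurable_snd

section Uniform

variable {ι F : Type*} [Field F] [Fintype F] [MeasurableSpace F] [DiscreteMeasurableSpace F]

/-- The law of independent uniform symbols. -/
noncomputable abbrev uniformSymbols (ι F : Type*) [Field F] [Fintype F] [MeasurableSpace F] :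
    Measure (ι → F) :=
  Measure.infinitePi fun _ : ι => (PMF.uniformOfFintype F).toMeasure

theorem uniform_apply_le {s : Set F} {k : ℕ} (hs : s.ncard ≤ k) :
    (PMF.uniformOfFintype F).toMeasure s ≤ k / Fintype.card F := by
  classical
  rw [PMF.toMeasure_uniformOfFintype_apply _ (MeasurableSet.of_discrete),
    ← Nat.card_eq_fintype_card, Nat.card_coe_set_eq]
  gcongr

theorem uniform_map_add (a : F) :
    (PMF.uniformOfFintype F).toMeasure.map (fun x => x + a) =
      (PMF.uniformOfFintype F).toMeasure := by
  classical
  ext s hs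
  rw [Measure.map_apply .of_discrete hs, PMF.toMeasure_uniformOfFintype_apply _ .of_discrete,
    PMF.toMeasure_uniformOfFintype_apply _ hs]
  congr 2
  exact Fintype.card_congr ((Equiv.addRight a).subtypeEquiv fun x => Iff.rfl)

theorem uniformSymbols_map_sub (a : ι → F) :
    (uniformSymbols ι F).map (fun x i => x i - a i) = uniformSymbols ι F := by
  rw [Measure.infinitePi_map_pi (f := fun i x => x - a i) _ fun i => .of_discrete]
  simp_rw [sub_eq_add_neg, uniform_map_add]

/-- Resampling one coordinate preserves the product law. This allows conditioning on all the other
symbols. -/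
theorem uniformSymbols_map_update [DecidableEq ι] (i : ι) :
    ((PMF.uniformOfFintype F).toMeasure.prod (uniformSymbols ι F)).map
      (fun p => Function.update p.2 i p.1) = uniformSymbols ι F := by
  refine Measure.eq_infinitePi _ fun s t ht => ?_
  rw [Measure.map_apply (measurable_update_uncurry i) (.pi s.countable_toSet fun _ _ => ht _)]
  by_cases hi : i ∈ s
  · have : (fun p : F × (ι → F) => Function.update p.2 i p.1) ⁻¹' ((s : Set ι).pi t)
        = t i ×ˢ (((s.erase i : Finset ι) : Set ι).pi t) := by
      ext p
      simp only [Set.mem_preimage, Set.mem_pi, Set.mem_prod, Finset.mem_coe, Finset.mem_erase]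
      constructor
      · intro h
        exact ⟨by simpa using h i hi, fun j hj => by simpa [hj.1] using h j hj.2⟩
      · rintro ⟨h1, h2⟩ j hj
        rcases eq_or_ne j i with rfl | hne
        · simpa using h1
        · simpa [hne] using h2 j ⟨hne, hj⟩
    rw [this, Measure.prod_prod, Measure.infinitePi_pi _ fun j _ => ht j,
      Finset.mul_prod_erase s (fun j => (PMF.uniformOfFintype F).toMeasure (t j)) hi]
  · have : (fun p : F × (ι → F) => Function.update p.2 i p.1) ⁻¹' ((s : Set ι).pi t)
        = Set.univ ×ˢ ((s : Set ι).pi t) := by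
      ext p
      simp only [Set.mem_preimage, Set.mem_pi, Set.mem_prod, Finset.mem_coe, Set.mem_univ,
        true_and]
      refine forall₂_congr fun j hj => ?_
      have hne : j ≠ i := by
        rintro rfl
        exact hi hj
      rw [Function.update_of_ne hne]
    rw [this, Measure.prod_prod, Measure.infinitePi_pi _ fun j _ => ht j]
    simp

theorem prod_apply_le_of_section {α β : Type*} [MeasurableSpace α] [MeasurableSpace β]
    {μ : Measure α} {ν : Measure β} [IsProbabilityMeasure μ] [SFinite ν] {s : Set (α × β)}
    (hs : MeasurableSet s) {r : ENNReal} (h : ∀ x, ν (Prod.mk x ⁻¹' s) ≤ r) :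
    μ.prod ν s ≤ r := by
  rw [Measure.prod_apply hs]
  calc _ ≤ ∫⁻ _, r ∂μ := lintegral_mono h
    _ = r := by simp

/-- An event that, given all symbols but one, leaves at most one value for that symbol. -/
theorem uniformSymbols_le_of_coord {B : Set (ι → F)} (hB : MeasurableSet B) (i : ι)
    (h : ∀ x y, (∀ j, j ≠ i → x j = y j) → x ∈ B → y ∈ B → x i = y i) :
    uniformSymbols ι F B ≤ 1 / Fintype.card F := by
  classical
  -- The symbol at `i` is redrawn independently. For fixed other symbols at most one of the q values
  -- stays in the event.
  rw [← uniformSymbols_map_update i, Measure.map_apply (measurable_update_uncurry i) hB,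
    ← Measure.prod_swap, Measure.map_apply measurable_swap (measurable_update_uncurry i hB)]
  refine prod_apply_le_of_section (measurable_swap (measurable_update_uncurry i hB)) fun x => ?_
  have := uniform_apply_le (F := F) (k := 1)
    (s := Prod.mk x ⁻¹' (Prod.swap ⁻¹' ((fun p : F × (ι → F) => Function.update p.2 i p.1) ⁻¹' B)))
    ((Set.ncard_le_one_iff (Set.toFinite _)).2 fun {a c} ha hc => by
      simpa using h _ _ (fun j hj => by simp [hj]) ha hc)
  simpa using this

end Uniform

/-- Such an event is the preimage of its own image under Φ. This supplies measurability without any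
regularity of Bob's basis choices. -/
theorem measurableSet_of_finite_dependence {α D : Type*} [MeasurableSpace α] [MeasurableSpace D]
    [DiscreteMeasurableSpace D] {Φ : α → D} (hΦ : Measurable Φ) {B : Set α}
    (h : ∀ x y, Φ x = Φ y → x ∈ B → y ∈ B) : MeasurableSet B := by
  have : B = Φ ⁻¹' (Φ '' B) := by
    ext x
    exact ⟨fun hx => ⟨x, hx, rfl⟩, fun ⟨y, hy, hxy⟩ => h y x hxy hy⟩
  rw [this]
  exact hΦ .of_discrete

theorem measurableSet_of_finite_coords {ι F κ : Type*} [Finite F] [MeasurableSpace F]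
    [DiscreteMeasurableSpace F] [Finite κ] (φ : κ → ι) {B : Set (ι → F)}
    (h : ∀ x y : ι → F, (∀ i, x (φ i) = y (φ i)) → x ∈ B → y ∈ B) : MeasurableSet B :=
  measurableSet_of_finite_dependence (Φ := fun x i => x (φ i)) (by fun_prop)
    fun x y hxy => h x y fun i => congrFun hxy i

namespace Network

/-! ### Transfer vectors -/

variable {V : Type*} {ne : ℕ} {F : Type*} [Field F] (N : Network V ne) (alice bob : V)

open scoped Classical in
/-- What `bob` receives when a unit symbol is injected into the hyperedge `e`. -/
noncomputable def transfer (f : Fin ne → Fin ne → F) (e : Fin ne) : Fin ne → F :=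
  (if bob ∈ N.head e then Pi.single e 1 else 0)
  + ∑ e' : {e' : Fin ne // N.Feeds alice e e'}, f e e'.1 • transfer f e'.1
termination_by ne - (e : ℕ)
decreasing_by
  have := e'.2.1
  have := e'.1.2
  omega

open scoped Classical in
theorem transfer_eq (f : Fin ne → Fin ne → F) (e : Fin ne) :
    N.transfer alice bob f e = (if bob ∈ N.head e then Pi.single e 1 else 0)
      + ∑ e', if N.Feeds alice e e' then f e e' • N.transfer alice bob f e' else 0 := by
  rw [transfer, ← Finset.sum_filter, ← Finset.sum_subtype_eq_sum_filter]
  congr 1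
  refine Finset.sum_bij (fun a _ => ⟨a.1, a.2⟩) ?_ ?_ ?_ ?_ <;> simp

open scoped Classical in
theorem packet_eq {C : Type*} (x : Fin ne → C → F) (f : Fin ne → Fin ne → F)
    (err : Fin ne → C → F) (e : Fin ne) :
    N.packet alice x f err e = ((if N.tail e = alice then x e else 0) + err e)
      + ∑ e', if N.Feeds alice e' e then f e' e • N.packet alice x f err e' else 0 := by
  rw [packet]
  by_cases h : N.tail e = alice
  · have : ∀ e', ¬ N.Feeds alice e' e := fun e' h' => h'.2.1 h
    simp [h, this]
  · rw [if_neg h, if_neg h, zero_add, add_comm, ← Finset.sum_filter,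
      ← Finset.sum_subtype_eq_sum_filter]
    congr 1
    refine Finset.sum_bij (fun a _ => ⟨a.1, a.2⟩) ?_ ?_ ?_ ?_ <;> simp

-- Superposition, by duality of two recursions: packets are computed forwards from the injected
-- symbols, transfer vectors backwards from Bob. Pairing them telescopes to the packets that Bob
-- hears.
open scoped Classical in
theorem received_eq_sum_transfer {C : Type*} (x : Fin ne → C → F) (f : Fin ne → Fin ne → F)
    (A : Finset (Fin ne)) (err : Fin ne → C → F) (r : Fin ne) (c : C) :
    N.received alice bob x f A err r c =
      ∑ e, N.transfer alice bob f e r *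
        ((if N.tail e = alice then x e c else 0) + (if e ∈ A then err e c else 0)) := by
  set P := N.packet alice x f (fun e' => if e' ∈ A then err e' else 0) with hP
  -- The packet recursion is solved for the symbol injected at `e`.
  have h1 : ∀ e, (if N.tail e = alice then x e c else 0) + (if e ∈ A then err e c else 0)
      = P e c - ∑ e', if N.Feeds alice e' e then f e' e * P e' c else 0 := by
    intro e
    have := congrFun (N.packet_eq alice x f (fun e' => if e' ∈ A then err e' else 0) e) c
    rw [← hP] at this
    simp only [Pi.add_apply, Finset.sum_apply, apply_ite (fun v : C → F => v c), Pi.zero_apply,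
      Pi.smul_apply, smul_eq_mul] at this
    rw [this]
    ring
  have h2 : ∀ e, N.transfer alice bob f e r =
      (if bob ∈ N.head e then (Pi.single e 1 : Fin ne → F) r else 0)
      + ∑ e', if N.Feeds alice e e' then f e e' * N.transfer alice bob f e' r else 0 := by
    intro e
    have := congrFun (N.transfer_eq alice bob f e) r
    simp only [Pi.add_apply, Finset.sum_apply, apply_ite (fun v : Fin ne → F => v r),
      Pi.zero_apply, Pi.smul_apply, smul_eq_mul] at this
    exact this
  -- Exchanging the order of summation moves the coefficients from the packets to the transfer
  -- vectors, where the backward recursion cancels them.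
  simp_rw [h1, mul_sub, Finset.sum_sub_distrib, Finset.mul_sum]
  rw [Finset.sum_comm, ← Finset.sum_sub_distrib]
  have h3 : ∀ e, N.transfer alice bob f e r * P e c - ∑ e', N.transfer alice bob f e' r *
      (if N.Feeds alice e e' then f e e' * P e c else 0)
        = (if bob ∈ N.head e then (Pi.single e 1 : Fin ne → F) r else 0) * P e c := by
    intro e
    nth_rw 1 [h2 e]
    rw [add_mul, Finset.sum_mul, add_sub_assoc, ← Finset.sum_sub_distrib,
      Finset.sum_eq_zero, add_zero]
    intro e' _
    split_ifs <;> ring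
  simp_rw [h3]
  rw [Finset.sum_eq_single r]
  · simp [received, hP]
  · intro e _ he
    simp [he.symm]
  · simp

/-- Symbols only travel to later hyperedges, so only coefficients leaving `e` or later hyperedges
matter. This permits varying one coefficient at `e` while later transfer vectors stay fixed. -/
theorem transfer_congr {f f' : Fin ne → Fin ne → F} (e : Fin ne)
    (h : ∀ a, e ≤ a → ∀ a', f a a' = f' a a') :
    N.transfer alice bob f e = N.transfer alice bob f' e := by
  classical
  induction hn : ne - (e : ℕ) using Nat.strong_induction_on generalizing e with
  | _ n ih =>
    rw [transfer_eq, transfer_eq]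
    congr 1
    refine Finset.sum_congr rfl fun e' _ => ?_
    split_ifs with h'
    · have h1 := h'.1
      have h2 := e'.2
      rw [h e le_rfl, ih (ne - e') (by omega) e' (fun a ha => h a (h1.le.trans ha)) rfl]
    · rfl

theorem transfer_apply_of_lt (f : Fin ne → Fin ne → F) {e r : Fin ne} (hr : r < e) :
    N.transfer alice bob f e r = 0 := by
  classical
  induction hn : ne - (e : ℕ) using Nat.strong_induction_on generalizing e with
  | _ n ih =>
    rw [transfer_eq]
    simp only [Pi.add_apply, Finset.sum_apply, apply_ite (fun v : Fin ne → F => v r),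
      Pi.zero_apply, Pi.smul_apply, smul_eq_mul]
    rw [Finset.sum_eq_zero]
    · simp [hr.ne]
    · intro e' _
      split_ifs with h'
      · have h1 := h'.1
        have h2 := e'.2
        rw [ih (ne - e') (by omega) (hr.trans h1) rfl, mul_zero]
      · rfl

/-! ### Rank and min cut -/

/-- The span of the transfer vectors of a set of hyperedges. -/
noncomputable def transferSpan (f : Fin ne → Fin ne → F) (S : Finset (Fin ne)) :
    Submodule F (Fin ne → F) :=
  Submodule.span F (N.transfer alice bob f '' S)

theorem minCut_le {S C : Finset (Fin ne)} (h : N.Separates alice bob S C) :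
    N.minCut alice bob S ≤ C.card :=
  Nat.sInf_le ⟨C, h, rfl⟩

theorem separates_self (S : Finset (Fin ne)) : N.Separates alice bob S S :=
  fun _ h h' => absurd h h'

theorem exists_separates (S : Finset (Fin ne)) :
    ∃ C, N.Separates alice bob S C ∧ C.card = N.minCut alice bob S :=
  Nat.sInf_mem (s := {k | ∃ C : Finset (Fin ne), N.Separates alice bob S C ∧ C.card = k})
    ⟨_, S, N.separates_self alice bob S, rfl⟩

theorem capacity_le_card_out : N.capacity alice bob ≤ (N.out alice).card :=
  N.minCut_le alice bob (N.separates_self alice bob _)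

/-- The transfer recursion is unrolled along all paths until they enter the cut. A hyperedge reached
outside the cut is not heard by Bob, so its direct term vanishes. -/
theorem transferSpan_le_of_separates (f : Fin ne → Fin ne → F) {S C : Finset (Fin ne)}
    (h : N.Separates alice bob S C) :
    N.transferSpan alice bob f S ≤ N.transferSpan alice bob f C := by
  classical
  refine Submodule.span_le.2 ?_
  rintro _ ⟨e₀, he₀, rfl⟩
  by_cases hC : e₀ ∈ C
  · exact Submodule.subset_span ⟨e₀, hC, rfl⟩
  have key : ∀ e, Relation.ReflTransGen (fun a a' => N.Feeds alice a a' ∧ a' ∉ C) e₀ e →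
      N.transfer alice bob f e ∈ N.transferSpan alice bob f C := by
    intro e
    induction hn : ne - (e : ℕ) using Nat.strong_induction_on generalizing e with
    | _ n ih =>
      intro hr
      rw [transfer_eq, if_neg (h e₀ he₀ hC e hr), zero_add]
      refine Submodule.sum_mem _ fun e' _ => ?_
      split_ifs with h'
      · have h1 := h'.1
        have h2 := e'.2
        refine Submodule.smul_mem _ _ ?_
        by_cases hC' : e' ∈ C
        · exact Submodule.subset_span ⟨e', hC', rfl⟩
        · exact ih (ne - e') (by omega) e' rfl (hr.tail ⟨h', hC'⟩)
      · exact Submodule.zero_mem _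
  exact key e₀ .refl

/-- Holds for all coefficients, so it limits Calvin even in the event of coincidences. -/
theorem finrank_transferSpan_le (f : Fin ne → Fin ne → F) (S : Finset (Fin ne)) :
    Module.finrank F (N.transferSpan alice bob f S) ≤ N.minCut alice bob S := by
  classical
  obtain ⟨C, hC, hcard⟩ := N.exists_separates alice bob S
  rw [← hcard]
  refine (Submodule.finrank_mono (N.transferSpan_le_of_separates alice bob f hC)).trans ?_
  rw [transferSpan, ← Finset.coe_image]
  exact (finrank_span_finset_le_card _).trans Finset.card_image_le

/-- No transfer vector is in the span of transfer vectors of later hyperedges by coincidence. -/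
def Generic (f : Fin ne → Fin ne → F) : Prop :=
  ∀ (e : Fin ne) (S : Finset (Fin ne)) (e' : Fin ne), (∀ a ∈ S, e < a) → N.Feeds alice e e' →
    N.transfer alice bob f e' ∉ N.transferSpan alice bob f S →
    N.transfer alice bob f e ∉ N.transferSpan alice bob f S

/-- A hyperedge that Bob does not hear acts only through those it feeds: a cut of these also stops
every path starting at `e`. -/
theorem minCut_mono_of_reach {S S' : Finset (Fin ne)} {e : Fin ne} (he : bob ∉ N.head e)
    (hS : S ⊆ insert e S') (hf : ∀ e', N.Feeds alice e e' → e' ∈ S') :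
    N.minCut alice bob S ≤ N.minCut alice bob S' := by
  classical
  obtain ⟨C, hC, hcard⟩ := N.exists_separates alice bob S'
  rw [← hcard]
  refine N.minCut_le alice bob fun e₀ he₀ hC₀ e₁ hr => ?_
  rcases Finset.mem_insert.1 (hS he₀) with rfl | h
  · rcases Relation.ReflTransGen.cases_head hr with rfl | ⟨e', h1, h2⟩
    · exact he
    · exact hC e' (hf e' h1.1) h1.2 e₁ h2
  · exact hC e₀ h hC₀ e₁ hr

theorem minCut_insert_le [DecidableEq (Fin ne)] (S : Finset (Fin ne)) (e : Fin ne) :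
    N.minCut alice bob (insert e S) ≤ N.minCut alice bob S + 1 := by
  obtain ⟨C, hC, hcard⟩ := N.exists_separates alice bob S
  rw [← hcard]
  refine (N.minCut_le alice bob (C := insert e C) fun e₀ he₀ hC₀ e₁ hr => ?_).trans
    (Finset.card_insert_le _ _)
  simp only [Finset.mem_insert, not_or] at he₀ hC₀ hr
  refine hC e₀ (he₀.resolve_left hC₀.1) hC₀.2 e₁ (Relation.ReflTransGen.mono (fun a a' h => ⟨h.1, h.2.2⟩) _ _ hr)

/-- A linear-algebraic max-flow argument that removes the earliest hyperedge e of S. Either its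
transfer vector is new, and rank and min cut are compared after one step, or it is redundant and e
can be replaced by the hyperedges it feeds. -/
theorem Generic.minCut_le_finrank {f : Fin ne → Fin ne → F} (hf : N.Generic alice bob f)
    (S : Finset (Fin ne)) :
    N.minCut alice bob S ≤ Module.finrank F (N.transferSpan alice bob f S) := by
  classical
  -- downward induction on a lower bound of `S`
  suffices H : ∀ n : ℕ, ∀ S : Finset (Fin ne), (∀ a ∈ S, ne ≤ (a : ℕ) + n) →
      N.minCut alice bob S ≤ Module.finrank F (N.transferSpan alice bob f S) from
    H ne S fun a _ => by omega
  intro n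
  induction n with
  | zero =>
    intro S hS
    have : S = ∅ := Finset.eq_empty_of_forall_notMem fun a ha => by
      have := hS a ha
      have := a.2
      omega
    subst this
    exact (N.minCut_le alice bob (N.separates_self alice bob ∅)).trans (by simp)
  | succ n ih =>
    intro S hS
    by_cases hn : ∃ e ∈ S, (e : ℕ) + (n + 1) = ne
    swap
    · refine ih S fun a ha => ?_
      have := hS a ha
      have : (a : ℕ) + (n + 1) ≠ ne := fun h => hn ⟨a, ha, h⟩
      omega
    obtain ⟨e, he, hen⟩ := hn
    set S' := S.erase e with hS'
    have hins : insert e S' = S := Finset.insert_erase he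
    have hlt : ∀ a ∈ S', e < a := fun a ha => by
      have h1 := hS a (Finset.mem_of_mem_erase ha)
      have h2 : a ≠ e := Finset.ne_of_mem_erase ha
      rw [Fin.lt_def]
      have : (a : ℕ) ≠ e := fun h => h2 (Fin.ext h)
      omega
    have hlow : ∀ a, e < a → ne ≤ (a : ℕ) + n := fun a ha => by
      rw [Fin.lt_def] at ha
      omega
    by_cases hnew : N.transfer alice bob f e ∈ N.transferSpan alice bob f S'
    -- Later transfer vectors vanish in coordinate `e`. If Bob heard `e`, this coordinate would be 1
    -- and the vector could not be redundant.
    · have hb : bob ∉ N.head e := by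
        intro hb
        have h1 : N.transferSpan alice bob f S' ≤ LinearMap.ker (LinearMap.proj (R := F) e) := by
          refine Submodule.span_le.2 ?_
          rintro _ ⟨a, ha, rfl⟩
          exact N.transfer_apply_of_lt alice bob f (hlt a ha)
        have h2 : N.transfer alice bob f e e = 0 := h1 hnew
        rw [transfer_eq] at h2
        simp only [Pi.add_apply, Finset.sum_apply, apply_ite (fun v : Fin ne → F => v e),
          Pi.zero_apply, Pi.smul_apply, smul_eq_mul, hb, if_true, Pi.single_eq_same] at h2
        rw [Finset.sum_eq_zero, add_zero] at h2
        · exact one_ne_zero h2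
        · intro e' _
          split_ifs with h'
          · rw [N.transfer_apply_of_lt alice bob f h'.1, mul_zero]
          · rfl
      -- Genericity puts the vectors of all hyperedges fed by `e` into the span of S', so the
      -- replacement does not enlarge the span, while it does not lower the min cut and consists of
      -- later hyperedges only.
      set S'' := S' ∪ Finset.univ.filter fun e' => N.Feeds alice e e' with hS''
      have h3 : N.transferSpan alice bob f S'' ≤ N.transferSpan alice bob f S' := by
        refine Submodule.span_le.2 ?_
        rintro _ ⟨a, ha, rfl⟩
        rcases Finset.mem_union.1 ha with h | h
        · exact Submodule.subset_span ⟨a, h, rfl⟩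
        · by_contra hno
          exact hf e S' a hlt (Finset.mem_filter.1 h).2 hno hnew
      calc N.minCut alice bob S ≤ N.minCut alice bob S'' := by
            refine N.minCut_mono_of_reach alice bob hb ?_ fun e' h => ?_
            · rw [← hins]
              exact Finset.insert_subset_insert _ Finset.subset_union_left
            · exact Finset.mem_union_right _ (by simpa using h)
        _ ≤ Module.finrank F (N.transferSpan alice bob f S'') := by
            refine ih S'' fun a ha => hlow a ?_
            rcases Finset.mem_union.1 ha with h | h
            · exact hlt a h
            · exact (Finset.mem_filter.1 h).2.1
        _ ≤ _ := Submodule.finrank_mono (h3.trans (Submodule.span_mono (Set.image_mono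
            (by simp [hS']))))
    -- A new vector raises the rank by at least one, whereas one more hyperedge raises the min cut
    -- by at most one.
    · have h1 := ih S' fun a ha => hlow a (hlt a ha)
      have h2 := N.minCut_insert_le alice bob S' e
      rw [hins] at h2
      have h3 : N.transferSpan alice bob f S' < N.transferSpan alice bob f S := by
        refine lt_of_le_of_ne (Submodule.span_mono (Set.image_mono
            (by simp [hS']))) fun h => hnew ?_
        rw [h]
        exact Submodule.subset_span ⟨e, he, rfl⟩
      have := Submodule.finrank_lt_finrank_of_lt h3
      omega

end Network

/-! ### Random linear encoding -/

section Encode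

variable {F : Type*} [Field F] {E : Type*} [AddCommGroup E] [Module F E] {κ : Type*} [Fintype κ]
  {b : ℕ}

/-- The linear combinations of the vectors `G` with the columns of the coefficient matrix `c`. -/
def encoded (G : κ → E) (c : κ → Fin b → F) (s : Fin b) : E := ∑ k, c k s • G k

/-- The span of `Err` and of the first `s` encoded vectors. -/
def encodedBelow (G : κ → E) (c : κ → Fin b → F) (Err : Submodule F E) (s : Fin b) :
    Submodule F E :=
  Err ⊔ Submodule.span F (encoded G c '' Set.Iio s)

/-- The span in question involves only columns before s, so it is the same for c and c'. The two
encoded vectors differ by a multiple of G k, and G k lies outside the span. -/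
theorem encoded_coord {G : κ → E} {c c' : κ → Fin b → F} {Err : Submodule F E} {k : κ} {s : Fin b}
    (h : ∀ k' s', (k', s') ≠ (k, s) → c k' s' = c' k' s')
    (hG : G k ∉ encodedBelow G c Err s) (hc : encoded G c s ∈ encodedBelow G c Err s)
    (hc' : encoded G c' s ∈ encodedBelow G c' Err s) : c k s = c' k s := by
  classical
  have hU : encodedBelow G c' Err s = encodedBelow G c Err s := by
    rw [encodedBelow, encodedBelow]
    congr 2
    refine Set.image_congr fun s' hs' => Finset.sum_congr rfl fun k' _ => ?_
    rw [h k' s' fun h' => (ne_of_lt (Set.mem_Iio.1 hs')) (Prod.ext_iff.1 h').2]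
  rw [hU] at hc'
  have h1 : encoded G c s - encoded G c' s = (c k s - c' k s) • G k := by
    rw [encoded, encoded, ← Finset.sum_sub_distrib, Finset.sum_eq_single k, sub_smul]
    · intro k' _ hk'
      rw [h k' s fun h' => hk' (Prod.ext_iff.1 h').1, sub_self]
    · simp
  by_contra hne
  refine hG ?_
  have h2 := Submodule.sub_mem _ hc hc'
  rw [h1] at h2
  exact (Submodule.smul_mem_iff _ (sub_ne_zero.2 hne)).1 h2

/-- Before each of the b encodings the span is too small to contain all generators, so genericity
makes every encoded vector new modulo Err and the earlier ones. -/
theorem encoded_injective_mod [FiniteDimensional F E] {G : κ → E} {c : κ → Fin b → F}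
    {Err : Submodule F E}
    (hdim : b + Module.finrank F Err ≤ Module.finrank F (Submodule.span F (Set.range G)))
    (hgen : ∀ s k, G k ∉ encodedBelow G c Err s → encoded G c s ∉ encodedBelow G c Err s)
    (v : Fin b → F) (hv : ∑ s, v s • encoded G c s ∈ Err) : v = 0 := by
  classical
  have hnot : ∀ s, encoded G c s ∉ encodedBelow G c Err s := by
    intro s hs
    have h1 : Submodule.span F (Set.range G) ≤ encodedBelow G c Err s := by
      refine Submodule.span_le.2 ?_
      rintro _ ⟨k, rfl⟩
      by_contra hk
      exact hgen s k hk hs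
    have h2 : Module.finrank F (Submodule.span F (encoded G c '' Set.Iio s)) ≤ s := by
      rw [← Finset.coe_Iio, ← Finset.coe_image]
      refine (finrank_span_finset_le_card _).trans (Finset.card_image_le.trans ?_)
      simp
    have h3 := (Submodule.finrank_mono h1).trans (Submodule.finrank_add_le_finrank_add_finrank _ _)
    have := s.2
    omega
  by_contra hne
  -- In a nontrivial relation the vector with the last nonzero coefficient would lie in the span
  -- below it.
  obtain ⟨s₀, hs₀⟩ := Function.ne_iff.1 hne
  obtain ⟨s, hs, hmax⟩ := (Finset.univ.filter fun s => v s ≠ 0).exists_maximal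
    ⟨s₀, by simpa using hs₀⟩
  simp only [Finset.mem_filter, Finset.mem_univ, true_and] at hs hmax
  refine hnot s ((Submodule.smul_mem_iff _ hs).1 ?_)
  rw [← Finset.add_sum_erase _ _ (Finset.mem_univ s)] at hv
  refine (Submodule.add_mem_iff_left _ (Submodule.sum_mem _ fun s' hs' => ?_)).1
    (Submodule.mem_sup_left hv)
  by_cases hz : v s' = 0
  · rw [hz, zero_smul]
    exact Submodule.zero_mem _
  · have hlt : s' < s := by
      refine lt_of_le_of_ne ?_ (Finset.ne_of_mem_erase hs')
      by_contra hle
      exact hle (hmax hz (le_of_not_ge hle))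
    exact Submodule.smul_mem _ _ (Submodule.mem_sup_right (Submodule.subset_span ⟨s', hlt, rfl⟩))

end Encode

/-! ### Subspaces of stacked vectors -/

section Stack

variable {F : Type*} [Field F] {τ R : Type*}

/-- The stacked vectors whose `k`-th block is in `P k`. -/
def stackedSubmodule (P : τ → Submodule F (R → F)) : Submodule F (τ × R → F) where
  carrier := {v | ∀ k, (fun r => v (k, r)) ∈ P k}
  add_mem' hv hw k := (P k).add_mem (hv k) (hw k)
  zero_mem' k := (P k).zero_mem
  smul_mem' a _ hv k := (P k).smul_mem a (hv k)

theorem finrank_stackedSubmodule [Fintype τ] [Finite R] (P : τ → Submodule F (R → F)) :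
    Module.finrank F (stackedSubmodule P) = ∑ k, Module.finrank F (P k) := by
  rw [← Module.finrank_pi_fintype F]
  refine LinearEquiv.finrank_eq
    { toFun := fun v k => ⟨fun r => v.1 (k, r), v.2 k⟩
      map_add' := fun _ _ => rfl
      map_smul' := fun _ _ => rfl
      invFun := fun v => ⟨fun r => (v r.1).1 r.2, fun k => (v k).2⟩
      left_inv := fun _ => rfl
      right_inv := fun _ => rfl }

/-- The stacked vector with the block `v` in place `k` and zeros elsewhere. -/
def stackSingle [DecidableEq τ] (k : τ) : (R → F) →ₗ[F] (τ × R → F) where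
  toFun v r := if r.1 = k then v r.2 else 0
  map_add' v w := by ext r; dsimp; split_ifs <;> simp
  map_smul' a v := by ext r; dsimp; split_ifs <;> simp

@[simp] theorem stackSingle_apply [DecidableEq τ] (k : τ) (v : R → F) (r : τ × R) :
    stackSingle k v r = if r.1 = k then v r.2 else 0 := rfl

theorem stackedSubmodule_le_span [Fintype τ] [DecidableEq τ] {ε : Type*} (g : τ → ε → R → F) :
    stackedSubmodule (fun k => Submodule.span F (Set.range (g k))) ≤
      Submodule.span F (Set.range fun x : τ × ε => stackSingle x.1 (g x.1 x.2)) := by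
  intro v hv
  have hsum : v = ∑ k, stackSingle k fun r => v (k, r) := by
    ext r
    simp [Finset.sum_apply]
  rw [hsum]
  refine Submodule.sum_mem _ fun k _ => ?_
  have : Submodule.span F (Set.range (g k)) ≤
      (Submodule.span F (Set.range fun x : τ × ε => stackSingle x.1 (g x.1 x.2))).comap
        (stackSingle k) := by
    refine Submodule.span_le.2 ?_
    rintro _ ⟨e, rfl⟩
    exact Submodule.subset_span ⟨(k, e), rfl⟩
  exact this (hv k)

end Stack

/-! ### Bob's linear equations -/

section Reduction

variable {F : Type*} [Field F] {R α β : Type*} [Fintype α] [Fintype β]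

/-- The selected rows are independent and as many as the rank, hence they span the row space. Column
relations seen on them are therefore valid on all rows. -/
theorem linear_eq_zero_of_rows {C : Type*} [Fintype C] [Finite R] {Y : Matrix R C F}
    {row : Fin Y.rank → R} (hrow : LinearIndependent F fun i => Y (row i))
    (l : (C → F) →ₗ[F] F) (hl : ∀ i, l (Y (row i)) = 0) (r : R) : l (Y r) = 0 := by
  have h1 : Submodule.span F (Set.range fun i => Y (row i)) = Submodule.span F (Set.range Y) := by
    refine Submodule.eq_of_le_of_finrank_eq (Submodule.span_mono ?_) ?_
    · rintro _ ⟨i, rfl⟩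
      exact ⟨row i, rfl⟩
    · rw [finrank_span_eq_card hrow, Fintype.card_fin]
      exact Y.rank_eq_finrank_span_row
  have h2 : Submodule.span F (Set.range fun i => Y (row i)) ≤ LinearMap.ker l := by
    refine Submodule.span_le.2 ?_
    rintro _ ⟨i, rfl⟩
    exact hl i
  rw [h1] at h2
  exact h2 (Submodule.subset_span ⟨r, rfl⟩)

theorem exists_independent_rows {C : Type*} [Fintype C] [Finite R] (Y : Matrix R C F) :
    ∃ row : Fin Y.rank → R, LinearIndependent F fun i => Y (row i) := by
  obtain ⟨κ, a, -, h2, h3⟩ := exists_linearIndependent' F (fun r => Y r)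
  have : Finite κ := h3.finite
  have : Fintype κ := Fintype.ofFinite κ
  have hcard : Fintype.card κ = Y.rank := by
    rw [Y.rank_eq_finrank_span_row, ← finrank_span_eq_card h3, h2]
    rfl
  let e : Fin Y.rank ≃ κ := (finCongr hcard.symm).trans (Fintype.equivFin κ).symm
  exact ⟨a ∘ e, h3.comp e e.injective⟩

/-- The independent rear columns extend to a basis of the column space by front columns; restricting
to a maximal set of independent rows loses nothing. -/
theorem nonempty_reduction [Finite R] {Y : Matrix R (α ⊕ β) F}
    (h : LinearIndependent F fun (j : β) (r : R) => Y r (Sum.inr j)) : Nonempty (Reduction Y) := by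
  classical
  set v : α ⊕ β → R → F := fun c r => Y r c with hv
  have h0 : LinearIndepOn F v (Set.range Sum.inr) :=
    (linearIndepOn_range_iff Sum.inr_injective v).2 h
  obtain ⟨B, -, hB, hspan, hind⟩ := exists_linearIndepOn_extension h0 (Set.subset_univ _)
  let A : Type _ := {c : α // Sum.inl c ∈ B}
  let e : A ≃ Fin (Fintype.card A) := Fintype.equivFin A
  let col : Fin (Fintype.card A) → α := fun i => (e.symm i).1
  let φ : Fin (Fintype.card A) ⊕ β → B := fun x => match x with
    | .inl i => ⟨Sum.inl (col i), (e.symm i).2⟩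
    | .inr j => ⟨Sum.inr j, hB ⟨j, rfl⟩⟩
  have hφ : ∀ x, (φ x).1 = Sum.map col id x := by rintro (i | j) <;> rfl
  have hφi : Function.Injective φ := by
    intro x y hxy
    have h1 : Sum.map col id x = Sum.map col id y := by rw [← hφ, ← hφ, hxy]
    exact (Sum.map_injective.2 ⟨Subtype.val_injective.comp e.symm.injective,
      Function.injective_id⟩) h1
  have hφs : Function.Surjective φ := by
    rintro ⟨c | j, hc⟩
    · exact ⟨.inl (e ⟨c, hc⟩), Subtype.ext (by simp [hφ, col])⟩
    · exact ⟨.inr j, rfl⟩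
  have hli : LinearIndependent F fun x => v (Sum.map col id x) := by
    have := hind.comp φ hφi
    simpa [Function.comp_def, hφ] using this
  have hrange : (Set.range fun x => v (Sum.map col id x)) = v '' B := by
    have : (fun x => v (Sum.map col id x)) = (fun c : B => v c) ∘ φ := by
      ext1 x; simp [hφ]
    rw [this, hφs.range_comp]
    ext y; simp
  have hsp : ∀ c, v c ∈ Submodule.span F (Set.range fun x => v (Sum.map col id x)) := by
    intro c
    rw [hrange]
    exact hspan ⟨c, trivial, rfl⟩
  obtain ⟨row, hrow⟩ := exists_independent_rows Y
  have hx := fun c : α => (Submodule.mem_span_range_iff_exists_fun F).1 (hsp (Sum.inl c))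
  choose x hx using hx
  refine ⟨⟨Fintype.card A, ?_, row, hrow, col, ?_, .of fun i c => x c (.inl i),
    .of fun j c => x c (.inr j), ?_⟩⟩
  · have h1 := finrank_span_eq_card hli
    rw [Fintype.card_sum, Fintype.card_fin] at h1
    rw [← h1, Y.rank_eq_finrank_span_cols]
    suffices h2 : Submodule.span F (Set.range fun x => v (Sum.map col id x))
        = Submodule.span F (Set.range Y.col) by rw [h2]
    refine le_antisymm (Submodule.span_le.2 ?_) (Submodule.span_le.2 ?_)
    · rintro _ ⟨y, rfl⟩
      exact Submodule.subset_span ⟨_, rfl⟩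
    · rintro _ ⟨c, rfl⟩
      exact hsp c
  -- A relation among the truncated columns extends to the full columns, which are independent.
  · rw [Fintype.linearIndependent_iff] at hli ⊢
    intro g hg
    refine hli g ?_
    ext r
    let l : ((α ⊕ β) → F) →ₗ[F] F := ∑ y, g y • LinearMap.proj (Sum.map col id y)
    have hl : ∀ r, l (Y r) = ∑ y, g y * Y r (Sum.map col id y) := fun r => by simp [l]
    have := linear_eq_zero_of_rows hrow l (fun i => by
      rw [hl]
      simpa using congrFun hg i) r
    rw [hl] at this
    simpa [hv] using this
  · ext i c
    have := congrFun (hx c) (row i)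
    simp only [Finset.sum_apply, Pi.smul_apply, smul_eq_mul, Fintype.sum_sum_type] at this
    rw [Matrix.submatrix_apply, ← show v (Sum.inl c) (row i) = Y (row i) (Sum.inl c) from rfl,
      ← this, Matrix.add_apply, Matrix.mul_apply, Matrix.mul_apply]
    simp [hv, mul_comm]

theorem Reduction.expand_all [Finite R] {Y : Matrix R (α ⊕ β) F} (ρ : Reduction Y) :
    Y.submatrix id Sum.inl = Y.submatrix id (Sum.inl ∘ ρ.col) * ρ.FZ
      + Y.submatrix id Sum.inr * ρ.FX := by
  ext r c
  let l : ((α ⊕ β) → F) →ₗ[F] F := LinearMap.proj (Sum.inl c)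
    - ∑ i, ρ.FZ i c • LinearMap.proj (Sum.inl (ρ.col i))
    - ∑ j, ρ.FX j c • LinearMap.proj (Sum.inr j)
  have hl : ∀ r, l (Y r) = Y r (Sum.inl c) - ∑ i, ρ.FZ i c * Y r (Sum.inl (ρ.col i))
      - ∑ j, ρ.FX j c * Y r (Sum.inr j) := fun r => by simp [l]
  have := linear_eq_zero_of_rows ρ.row_indep l (fun i => by
    rw [hl]
    have := congrFun (congrFun ρ.expand i) c
    simp only [Matrix.submatrix_apply, Matrix.add_apply, Matrix.mul_apply,
      Function.comp_apply] at this
    rw [this]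
    simp [mul_comm]) r
  rw [hl] at this
  simp only [Matrix.submatrix_apply, Matrix.add_apply, Matrix.mul_apply, Function.comp_apply, id]
  rw [sub_sub, sub_eq_zero] at this
  rw [this]
  simp [mul_comm]

/-- The rear columns belong to a basis, so `That` has trivial kernel and can be cancelled from the
left. -/
theorem Reduction.match_iff {Y : Matrix R (α ⊕ β) F} (ρ : Reduction Y) (U : Matrix β α F) :
    ρ.Match U ↔ U = U.submatrix id ρ.col * ρ.FZ + ρ.FX := by
  have hinj : ∀ x : β → F, ρ.That.mulVec x = 0 → x = 0 := by
    intro x hx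
    have h := Fintype.linearIndependent_iff.1 (ρ.col_indep.comp Sum.inr Sum.inr_injective) x
    refine funext (h ?_)
    ext i
    have := congrFun hx i
    simpa [Matrix.mulVec, dotProduct, That, mul_comm] using this
  rw [Reduction.Match]
  constructor
  · intro h
    have h1 : ρ.That * (U - U.submatrix id ρ.col * ρ.FZ - ρ.FX) = 0 := by
      rw [Matrix.mul_sub, Matrix.mul_sub, ← Matrix.mul_assoc, h, sub_self]
    have h2 : U - U.submatrix id ρ.col * ρ.FZ - ρ.FX = 0 := by
      ext j c
      refine congrFun (hinj (fun j => (U - U.submatrix id ρ.col * ρ.FZ - ρ.FX) j c) ?_) j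
      ext i
      exact congrFun (congrFun h1 i) c
    rw [sub_sub, sub_eq_zero] at h2
    exact h2
  · intro h
    nth_rw 1 [h]
    rw [Matrix.mul_add, ← Matrix.mul_assoc, add_sub_cancel_left]

/-- A solution is determined by its columns in the a basis positions. -/
theorem Reduction.ncard_match_le [Fintype F] {Y : Matrix R (α ⊕ β) F} (ρ : Reduction Y) :
    {U : Matrix β α F | ρ.Match U}.ncard ≤ Fintype.card F ^ (Fintype.card β * ρ.a) := by
  classical
  have h := Set.ncard_le_ncard_of_injOn (s := {U : Matrix β α F | ρ.Match U})
    (t := (Set.univ : Set (β × Fin ρ.a → F))) (fun U p => U p.1 (ρ.col p.2))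
    (fun _ _ => trivial) (fun U hU U' hU' hUU' => by
      have h1 : U.submatrix id ρ.col = U'.submatrix id ρ.col := by
        ext j i
        exact congrFun hUU' (j, i)
      rw [(ρ.match_iff U).1 hU, (ρ.match_iff U').1 hU', h1])
  refine h.trans (le_of_eq ?_)
  rw [Set.ncard_univ, Nat.card_eq_fintype_card, Fintype.card_fun, Fintype.card_prod,
    Fintype.card_fin]

variable [DecidableEq β]

/-- The column relation of Y, with the noiseless part isolated, says that T times the defect of U is
a combination of error columns. Injectivity of T modulo these makes the defect zero. -/
theorem Reduction.match_of_injective_mod [Finite R] {Y : Matrix R (α ⊕ β) F} (ρ : Reduction Y)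
    {T : Matrix R β F} {U : Matrix β α F} {Err : Submodule F (R → F)}
    (hY : ∀ c, (fun r => (Y - T * Matrix.fromCols U (1 : Matrix β β F)) r c) ∈ Err)
    (hT : ∀ v : β → F, T.mulVec v ∈ Err → v = 0) : ρ.Match U := by
  rw [ρ.match_iff]
  set E := Y - T * Matrix.fromCols U (1 : Matrix β β F) with hE
  have hf : T * U = Y.submatrix id Sum.inl - E.submatrix id Sum.inl := by
    rw [hE, Matrix.mul_fromCols]
    ext r c
    simp
  have hr : T = Y.submatrix id Sum.inr - E.submatrix id Sum.inr := by
    rw [hE, Matrix.mul_fromCols]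
    ext r c
    simp
  have ha : T * U.submatrix id ρ.col
      = Y.submatrix id (Sum.inl ∘ ρ.col) - E.submatrix id (Sum.inl ∘ ρ.col) := by
    have := congrArg (fun Z : Matrix R α F => Z.submatrix id ρ.col) hf
    exact this
  have key : T * (U - U.submatrix id ρ.col * ρ.FZ - ρ.FX) =
      -(E.submatrix id Sum.inl - E.submatrix id (Sum.inl ∘ ρ.col) * ρ.FZ
        - E.submatrix id Sum.inr * ρ.FX) := by
    rw [Matrix.mul_sub, Matrix.mul_sub, ← Matrix.mul_assoc, hf, ha]
    nth_rw 1 [hr]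
    rw [ρ.expand_all]
    simp only [Matrix.sub_mul]
    abel
  have h0 : ∀ c, (fun j => (U - U.submatrix id ρ.col * ρ.FZ - ρ.FX) j c) = 0 := by
    intro c
    refine hT _ ?_
    have h1 : T.mulVec (fun j => (U - U.submatrix id ρ.col * ρ.FZ - ρ.FX) j c)
        = -((fun r => E r (Sum.inl c)) - ∑ i, ρ.FZ i c • (fun r => E r (Sum.inl (ρ.col i)))
          - ∑ j, ρ.FX j c • (fun r => E r (Sum.inr j))) := by
      ext r
      have := congrFun (congrFun key r) c
      rw [Matrix.mul_apply] at this
      rw [Matrix.mulVec, dotProduct, this]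
      simp [Matrix.mul_apply, mul_comm]
    rw [h1]
    exact Submodule.neg_mem _ (Submodule.sub_mem _ (Submodule.sub_mem _ (hY _)
      (Submodule.sum_mem _ fun i _ => Submodule.smul_mem _ _ (hY _)))
      (Submodule.sum_mem _ fun i _ => Submodule.smul_mem _ _ (hY _)))
  have h2 : U - U.submatrix id ρ.col * ρ.FZ - ρ.FX = 0 := by
    ext j c
    exact congrFun (h0 c) j
  rw [sub_sub, sub_eq_zero] at h2
  exact h2

/-- The rear columns of Y are those of T up to errors, so a relation among them would place a
combination of the columns of T in Err. -/
theorem nonempty_reduction_of_injective_mod [Finite R] {Y : Matrix R (α ⊕ β) F}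
    {T : Matrix R β F} {U : Matrix β α F} {Err : Submodule F (R → F)}
    (hY : ∀ c, (fun r => (Y - T * Matrix.fromCols U (1 : Matrix β β F)) r c) ∈ Err)
    (hT : ∀ v : β → F, T.mulVec v ∈ Err → v = 0) : Nonempty (Reduction Y) := by
  refine nonempty_reduction (Fintype.linearIndependent_iff.2 fun g hg => congrFun (hT g ?_))
  have h1 : T.mulVec g = -∑ j, g j • (fun r => (Y - T * Matrix.fromCols U (1 : Matrix β β F)) r (Sum.inr j)) := by
    ext r
    have := congrFun hg r
    simp only [Finset.sum_apply, Pi.smul_apply, smul_eq_mul, Pi.zero_apply] at this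
    simp [Matrix.mul_fromCols, Matrix.mulVec, dotProduct, mul_sub, this, mul_comm]
  rw [h1]
  exact Submodule.neg_mem _ (Submodule.sum_mem _ fun j _ => Submodule.smul_mem _ _ (hY _))

/-- The noiseless part has rank at most the number of rear columns; the surplus rank comes from the
errors. No genericity is involved, so the candidate count holds at every stage and for all coins. -/
theorem Reduction.a_le_finrank [Finite R] {Y : Matrix R (α ⊕ β) F} (ρ : Reduction Y)
    {T : Matrix R β F} {U : Matrix β α F} {Err : Submodule F (R → F)}
    (hY : ∀ c, (fun r => (Y - T * Matrix.fromCols U (1 : Matrix β β F)) r c) ∈ Err) :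
    ρ.a ≤ Module.finrank F Err := by
  classical
  have : Fintype R := Fintype.ofFinite R
  set P := T * Matrix.fromCols U (1 : Matrix β β F) with hP
  have h1 : Submodule.span F (Set.range Y.col) ≤ Submodule.span F (Set.range P.col) ⊔ Err := by
    refine Submodule.span_le.2 ?_
    rintro _ ⟨c, rfl⟩
    have : Y.col c = P.col c + fun r => (Y - P) r c := by
      ext r; simp [Matrix.col]
    rw [this]
    exact Submodule.add_mem _ (Submodule.mem_sup_left (Submodule.subset_span ⟨c, rfl⟩))
      (Submodule.mem_sup_right (hY c))
  have h2 := (Submodule.finrank_mono h1).trans (Submodule.finrank_add_le_finrank_add_finrank _ _)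
  rw [← Matrix.rank_eq_finrank_span_cols, ← Matrix.rank_eq_finrank_span_cols] at h2
  have h3 : P.rank ≤ Fintype.card β :=
    (Matrix.rank_mul_le_left _ _).trans (Matrix.rank_le_card_width T)
  have := ρ.rank_eq
  omega

end Reduction

/-! ### Transfer matrices of the long and of the short packets -/

section Transfer

variable {V : Type*} {ne : ℕ} {F : Type*} [Field F] {p : Params}

open scoped Classical in
/-- The transfer vectors of the hyperedges of `alice`, and zero for the other hyperedges. -/
noncomputable def Network.sourceTransfer (N : Network V ne) (alice bob : V)
    (f : Fin ne → Fin ne → F) (e : Fin ne) : Fin ne → F :=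
  if N.tail e = alice then N.transfer alice bob f e else 0

theorem Network.capacity_le_finrank_sourceTransfer (N : Network V ne) (alice bob : V)
    {f : Fin ne → Fin ne → F} (hf : N.Generic alice bob f) :
    N.capacity alice bob
      ≤ Module.finrank F (Submodule.span F (Set.range (N.sourceTransfer alice bob f))) := by
  classical
  refine (Generic.minCut_le_finrank N alice bob hf (N.out alice)).trans
    (Submodule.finrank_mono (Submodule.span_mono ?_))
  rintro _ ⟨e, he, rfl⟩
  have : N.tail e = alice := (Finset.mem_filter.1 he).2
  exact ⟨e, by simp [sourceTransfer, this]⟩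

open scoped Classical in
theorem Network.received_mul {β C : Type*} [Fintype β] (N : Network V ne) (alice bob : V)
    {x : Fin ne → C → F} (K : Matrix (Fin ne) β F) (X : Matrix β C F)
    (hx : ∀ e c, x e c = (K * X) e c) (f : Fin ne → Fin ne → F)
    (A : Finset (Fin ne)) (err : Fin ne → C → F) (r : Fin ne) (c : C) :
    N.received alice bob x f A err r c =
      ∑ s, (∑ e, N.sourceTransfer alice bob f e r * K e s) * X s c
        + ∑ e, N.transfer alice bob f e r * (if e ∈ A then err e c else 0) := by
  rw [received_eq_sum_transfer]
  simp only [mul_add, Finset.sum_add_distrib]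
  congr 1
  simp only [Finset.sum_mul]
  rw [Finset.sum_comm]
  refine Finset.sum_congr rfl fun e _ => ?_
  unfold sourceTransfer
  split_ifs with h
  · rw [hx, Matrix.mul_apply, Finset.mul_sum]
    exact Finset.sum_congr rfl fun s _ => by ring
  · simp

open scoped Classical in
theorem Network.sum_transfer_mem_transferSpan (N : Network V ne) (alice bob : V)
    (f : Fin ne → Fin ne → F) (A : Finset (Fin ne)) (w : Fin ne → F) :
    (fun r => ∑ e, N.transfer alice bob f e r * (if e ∈ A then w e else 0))
      ∈ N.transferSpan alice bob f A := by
  have : (fun r => ∑ e, N.transfer alice bob f e r * (if e ∈ A then w e else 0))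
      = ∑ e, (if e ∈ A then w e else 0) • N.transfer alice bob f e := by
    ext r
    simp only [Finset.sum_apply, Pi.smul_apply, smul_eq_mul, mul_comm]
  rw [this]
  refine Submodule.sum_mem _ fun e _ => ?_
  split_ifs with h
  · exact Submodule.smul_mem _ _ (Submodule.subset_span ⟨e, h, rfl⟩)
  · simp

/-! #### Long packets -/

/-- The node coefficients for the long packets of stage `k`. -/
def longNodeCoef (pub : PubCoin p ne → F) (k : ℕ) : Fin ne → Fin ne → F :=
  fun e' e => pub (.longNode k e' e)

/-- The node coefficients for the short packets of stage `k`. -/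
def shortNodeCoef (pub : PubCoin p ne → F) (k : ℕ) : Fin ne → Fin ne → F :=
  fun e' e => pub (.shortNode k e' e)

variable (alice bob : V) {t : ℕ}

/-- What `bob` receives in `t` stages from unit symbols on the hyperedges of `alice`. -/
noncomputable def longGen (N : Fin t → Network V ne) (pub : PubCoin p ne → F)
    (x : Fin t × Fin ne) : Fin t × Fin ne → F :=
  stackSingle x.1 ((N x.1).sourceTransfer alice bob (longNodeCoef pub x.1) x.2)

/-- The coefficients of Alice for the long packets. -/
def longCoef (t : ℕ) (pub : PubCoin p ne → F) (x : Fin t × Fin ne) (s : Fin p.b) : F :=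
  pub (.longEnc x.1 x.2 s)

/-- What Calvin can inject in `t` stages by attacking the hyperedges of `A`. -/
noncomputable def longErrSpan (N : Fin t → Network V ne) (A : Fin t → Finset (Fin ne))
    (pub : PubCoin p ne → F) : Submodule F (Fin t × Fin ne → F) :=
  stackedSubmodule fun k => (N k).transferSpan alice bob (longNodeCoef pub k) (A k)

/-- The transfer matrix from the rows of `X₀` to `bob`. -/
noncomputable def longTransfer (N : Fin t → Network V ne) (pub : PubCoin p ne → F) :
    Matrix (Fin t × Fin ne) (Fin p.b) F :=
  .of fun r s => encoded (longGen alice bob N pub) (longCoef t pub) s r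

theorem longTransfer_apply (N : Fin t → Network V ne) (pub : PubCoin p ne → F) (k : Fin t)
    (r : Fin ne) (s : Fin p.b) :
    longTransfer alice bob N pub (k, r) s =
      ∑ e, (N k).sourceTransfer alice bob (longNodeCoef pub k) e r * pub (.longEnc k e s) := by
  simp only [longTransfer, Matrix.of_apply, encoded, Finset.sum_apply, Fintype.sum_prod_type,
    Pi.smul_apply, longGen, stackSingle_apply, longCoef, smul_eq_mul]
  rw [Finset.sum_eq_single k]
  · simp [mul_comm]
  · intro k' _ hk'
    simp [hk'.symm]
  · simp

/-- By superposition, what remains after removing Alice's contribution is, in each stage, a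
combination of transfer vectors of attacked hyperedges. -/
theorem longStage_residual_mem (N : Fin t → Network V ne) (W : Message p F)
    (pub : PubCoin p ne → F) (a : ∀ k : ℕ, Attack p ne F k)
    (Y : ℕ → Matrix (Fin ne) (LongCol p) F)
    (hY : ∀ k : Fin t, Y k = longStage alice bob (N k) W pub k (a k)) (c : LongCol p) :
    (fun r => (stackLong t Y - longTransfer alice bob N pub * Matrix.fromCols W (1 : Matrix (Fin p.b) (Fin p.b) F)) r c)
      ∈ longErrSpan alice bob N (fun k => (a k).longSet) pub := by
  classical
  intro k
  convert (N k).sum_transfer_mem_transferSpan alice bob (longNodeCoef pub k) (a k).longSet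
    (fun e => (a k).longErr e c) using 1
  ext r
  beta_reduce
  rw [Matrix.sub_apply, Matrix.mul_apply, stackLong, hY, longStage,
    Network.received_mul (hx := fun _ _ => rfl)]
  simp only [longTransfer_apply, Matrix.of_apply]
  exact add_sub_cancel_left _ _

theorem finrank_longErrSpan_le (N : Fin t → Network V ne) (A : Fin t → Finset (Fin ne))
    (pub : PubCoin p ne → F) :
    Module.finrank F (longErrSpan alice bob N A pub) ≤ ∑ k, (N k).minCut alice bob (A k) := by
  rw [longErrSpan, finrank_stackedSubmodule]
  exact Finset.sum_le_sum fun k _ => (N k).finrank_transferSpan_le _ _ _ _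

/-- The coefficients of Alice for the long packets do not lose rank by coincidence. -/
def LongGeneric (N : Fin t → Network V ne) (A : Fin t → Finset (Fin ne))
    (pub : PubCoin p ne → F) : Prop :=
  ∀ s x, longGen alice bob N pub x ∉ encodedBelow (longGen alice bob N pub) (longCoef t pub)
      (longErrSpan alice bob N A pub) s →
    encoded (longGen alice bob N pub) (longCoef t pub) s ∉
      encodedBelow (longGen alice bob N pub) (longCoef t pub) (longErrSpan alice bob N A pub) s

/-- The cut condition accumulated over stages leaves room for b dimensions: Alice's generators span
at least ∑ capacities, Calvin's errors at most ∑ min cuts. -/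
theorem longTransfer_injective_mod {N : Fin t → Network V ne} {A : Fin t → Finset (Fin ne)}
    {pub : PubCoin p ne → F} (hN : ∀ k, (N k).Generic alice bob (longNodeCoef pub k))
    (hgen : LongGeneric alice bob N A pub)
    (hcut : p.b + ∑ k, (N k).minCut alice bob (A k) ≤ ∑ k, (N k).capacity alice bob)
    (v : Fin p.b → F)
    (hv : (longTransfer alice bob N pub).mulVec v ∈ longErrSpan alice bob N A pub) : v = 0 := by
  refine encoded_injective_mod (G := longGen alice bob N pub) (c := longCoef t pub) ?_ hgen v ?_
  · calc _ ≤ p.b + ∑ k, (N k).minCut alice bob (A k) :=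
          Nat.add_le_add_left (finrank_longErrSpan_le alice bob N A pub) _
      _ ≤ ∑ k, (N k).capacity alice bob := hcut
      _ ≤ ∑ k, Module.finrank F (Submodule.span F
            (Set.range ((N k).sourceTransfer alice bob (longNodeCoef pub k)))) :=
          Finset.sum_le_sum fun k _ => (N k).capacity_le_finrank_sourceTransfer alice bob (hN k)
      _ = _ := (finrank_stackedSubmodule _).symm
      _ ≤ _ := Submodule.finrank_mono (stackedSubmodule_le_span
            fun k => (N k).sourceTransfer alice bob (longNodeCoef pub k))
  · convert hv using 1
    ext r
    simp [longTransfer, Matrix.mulVec, dotProduct, mul_comm]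

/-! #### Short packets -/

/-- The coefficients of Alice in stage `k` for the rows of `L` that are new in stage `k`. -/
def shortCoef (k : ℕ) (pub : PubCoin p ne → F) (e : Fin ne) (u : Fin p.σ) : F :=
  pub (.shortEnc k e (Fin.last k, u))

/-- The transfer matrix from the rows of `L` to `bob`. -/
noncomputable def shortTransfer (N : Fin t → Network V ne) (pub : PubCoin p ne → F) :
    Matrix (Fin t × Fin ne) (ShortRear p t) F :=
  .of fun r j => if h : (j.1 : ℕ) < (r.1 : ℕ) + 1 then
    ∑ e, (N r.1).sourceTransfer alice bob (shortNodeCoef pub r.1) e r.2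
      * pub (.shortEnc r.1 e (⟨j.1, h⟩, j.2)) else 0

/-- What Calvin can inject into the short packets in `t` stages. -/
noncomputable def shortErrSpan (N : Fin t → Network V ne) (A : Fin t → Finset (Fin ne))
    (pub : PubCoin p ne → F) : Submodule F (Fin t × Fin ne → F) :=
  stackedSubmodule fun k => (N k).transferSpan alice bob (shortNodeCoef pub k) (A k)

theorem finrank_shortErrSpan_le (N : Fin t → Network V ne) (A : Fin t → Finset (Fin ne))
    (pub : PubCoin p ne → F) :
    Module.finrank F (shortErrSpan alice bob N A pub) ≤ ∑ k, (N k).minCut alice bob (A k) := by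
  rw [shortErrSpan, finrank_stackedSubmodule]
  exact Finset.sum_le_sum fun k _ => (N k).finrank_transferSpan_le _ _ _ _

theorem sum_fin_dite_lt {M : Type*} [AddCommMonoid M] {s t : ℕ} (hst : s ≤ t) (g : Fin s → M) :
    ∑ j : Fin t, (if h : (j : ℕ) < s then g ⟨j, h⟩ else 0) = ∑ j : Fin s, g j := by
  rw [Fin.sum_univ_eq_sum_range (fun j => if h : j < s then g ⟨j, h⟩ else 0) t,
    Finset.sum_fin_eq_sum_range]
  refine (Finset.sum_subset (Finset.range_subset_range.2 hst) fun j _ hj => ?_).symm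
  rw [dif_neg (by simpa using hj)]

/-- A row of the stacked matrix `L` of `k + 1` stages, padded to the width of `t` stages. -/
theorem shortSource_pad {l : SecretIdx p → F} (k : Fin t) (j : Fin ((k : ℕ) + 1)) (u : Fin p.σ)
    (c : ShortCol p t) :
    shortSource t l (⟨j, j.2.trans_le k.2⟩, u) c = match c with
      | .inl (c, u') => if hc : (c : ℕ) < (k : ℕ) + 1 then
          shortSource (k + 1) l (j, u) (.inl (⟨c, hc⟩, u')) else 0
      | .inr (c, u') => if hc : (c : ℕ) < (k : ℕ) + 1 then
          shortSource (k + 1) l (j, u) (.inr (⟨c, hc⟩, u')) else 0 := by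
  have hj := j.2
  rcases c with ⟨c, u'⟩ | ⟨c, u'⟩
  · simp only [shortSource, Matrix.fromCols_apply_inl, shortFrontMatrix, upTo]
    split_ifs <;> first | rfl | omega
  · simp only [shortSource, Matrix.fromCols_apply_inr, Matrix.one_apply, Prod.mk.injEq,
      Fin.ext_iff]
    split_ifs <;> first | rfl | omega

/-- As for the long packets. The columns that do not exist yet in stage k are zero in the padded
received matrix and in the padded rows of L. -/
theorem shortStage_residual_mem (N : Fin t → Network V ne) (l : SecretIdx p → F)
    (pub : PubCoin p ne → F) (a : ∀ k : ℕ, Attack p ne F k)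
    (J : ∀ k : ℕ, Matrix (Fin ne) (ShortCol p (k + 1)) F)
    (hJ : ∀ k : Fin t, J k = shortStage alice bob (N k) l pub k (a k)) (c : ShortCol p t) :
    (fun r => (stackShort t J - shortTransfer alice bob N pub *
      Matrix.fromCols (shortFrontMatrix t (upTo t l))
        (1 : Matrix (ShortRear p t) (ShortRear p t) F)) r c)
      ∈ shortErrSpan alice bob N (fun k => (a k).shortSet) pub := by
  classical
  intro k
  have hT : ∀ r, (shortTransfer alice bob N pub *
      Matrix.fromCols (shortFrontMatrix t (upTo t l))
        (1 : Matrix (ShortRear p t) (ShortRear p t) F)) (k, r) c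
      = ∑ j : ShortRear p (k + 1), (∑ e, (N k).sourceTransfer alice bob (shortNodeCoef pub k) e r
        * pub (.shortEnc k e j)) * shortSource t l (⟨j.1, j.1.2.trans_le k.2⟩, j.2) c := by
    intro r
    rw [Matrix.mul_apply, Fintype.sum_prod_type, Fintype.sum_prod_type,
      ← sum_fin_dite_lt (show (k : ℕ) + 1 ≤ t from k.2)]
    refine Finset.sum_congr rfl fun j _ => ?_
    by_cases h : (j : ℕ) < (k : ℕ) + 1
    · rw [dif_pos h]
      refine Finset.sum_congr rfl fun u _ => ?_
      simp only [shortTransfer, Matrix.of_apply, dif_pos h]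
      rfl
    · rw [dif_neg h]
      refine Finset.sum_eq_zero fun u _ => ?_
      simp only [shortTransfer, Matrix.of_apply, dif_neg h, zero_mul]
  have hJk : ∀ r c', J k r c' = ∑ j : ShortRear p (k + 1),
      (∑ e, (N k).sourceTransfer alice bob (shortNodeCoef pub k) e r
        * pub (.shortEnc k e j)) * shortSource (k + 1) l j c'
      + ∑ e, (N k).transfer alice bob (shortNodeCoef pub k) e r *
          (if e ∈ (a k).shortSet then (a k).shortErr e c' else 0) := by
    intro r c'
    rw [hJ, shortStage, Network.received_mul (hx := fun _ _ => rfl)]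
    rfl
  simp only [Matrix.sub_apply, hT]
  have hpad := fun j : ShortRear p (k + 1) => shortSource_pad (l := l) k j.1 j.2 c
  simp only [hpad]
  have hmem := fun c' => (N k).sum_transfer_mem_transferSpan alice bob (shortNodeCoef pub k)
    (a k).shortSet fun e => (a k).shortErr e c'
  rcases c with ⟨c, u⟩ | ⟨c, u⟩
  · by_cases hc : (c : ℕ) < (k : ℕ) + 1
    · simp only [stackShort, dif_pos hc, hJk, add_sub_cancel_left]
      exact hmem (.inl (⟨c, hc⟩, u))
    · simp only [stackShort, dif_neg hc, mul_zero, Finset.sum_const_zero, sub_zero]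
      exact Submodule.zero_mem _
  · by_cases hc : (c : ℕ) < (k : ℕ) + 1
    · simp only [stackShort, dif_pos hc, hJk, add_sub_cancel_left]
      exact hmem (.inr (⟨c, hc⟩, u))
    · simp only [stackShort, dif_neg hc, mul_zero, Finset.sum_const_zero, sub_zero]
      exact Submodule.zero_mem _

/-- The coefficients of Alice for the short packets do not lose rank by coincidence. -/
def ShortGeneric (N : Network V ne) (A : Finset (Fin ne)) (pub : PubCoin p ne → F) (k : ℕ) :
    Prop :=
  ∀ s x, N.sourceTransfer alice bob (shortNodeCoef pub k) x ∉
      encodedBelow (N.sourceTransfer alice bob (shortNodeCoef pub k)) (shortCoef k pub)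
        (N.transferSpan alice bob (shortNodeCoef pub k) A) s →
    encoded (N.sourceTransfer alice bob (shortNodeCoef pub k)) (shortCoef k pub) s ∉
      encodedBelow (N.sourceTransfer alice bob (shortNodeCoef pub k)) (shortCoef k pub)
        (N.transferSpan alice bob (shortNodeCoef pub k) A) s

/-- The transfer matrix is block lower triangular, and each diagonal block is injective modulo the
errors of its own stage by the margin σ. Forward substitution over the stages finishes. -/
theorem shortTransfer_injective_mod {N : Fin t → Network V ne} {A : Fin t → Finset (Fin ne)}
    {pub : PubCoin p ne → F} (hN : ∀ k, (N k).Generic alice bob (shortNodeCoef pub k))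
    (hgen : ∀ k, ShortGeneric alice bob (N k) (A k) pub k)
    (hcut : ∀ k, p.σ + (N k).minCut alice bob (A k) ≤ (N k).capacity alice bob)
    (v : ShortRear p t → F)
    (hv : (shortTransfer alice bob N pub).mulVec v ∈ shortErrSpan alice bob N A pub) : v = 0 := by
  suffices H : ∀ n : ℕ, ∀ k : Fin t, (k : ℕ) = n → (fun u => v (k, u)) = 0 by
    ext ⟨k, u⟩
    exact congrFun (H k k rfl) u
  intro n
  induction n using Nat.strong_induction_on with
  | _ n ih =>
    intro k hk
    refine encoded_injective_mod (G := (N k).sourceTransfer alice bob (shortNodeCoef pub k))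
      (c := shortCoef k pub)
      (Err := (N k).transferSpan alice bob (shortNodeCoef pub k) (A k)) ?_ (hgen k) _ ?_
    · exact (Nat.add_le_add_left ((N k).finrank_transferSpan_le alice bob _ _) _).trans
        ((hcut k).trans ((N k).capacity_le_finrank_sourceTransfer alice bob (hN k)))
    · convert hv k using 1
      ext r
      simp only [Matrix.mulVec, dotProduct, Fintype.sum_prod_type]
      rw [Finset.sum_eq_single k]
      · simp only [Finset.sum_apply, Pi.smul_apply, smul_eq_mul, encoded, shortTransfer,
          Matrix.of_apply, Nat.lt_succ_self, dif_pos, shortCoef]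
        refine Finset.sum_congr rfl fun u _ => ?_
        rw [mul_comm]
        congr 1
        refine Finset.sum_congr rfl fun e _ => ?_
        rw [mul_comm]
        rfl
      · intro j _ hj
        refine Finset.sum_eq_zero fun u _ => ?_
        by_cases h : (j : ℕ) < (k : ℕ) + 1
        · have hne : (j : ℕ) ≠ k := fun h' => hj (Fin.ext h')
          have := congrFun (ih j (by omega) j rfl) u
          simp only [Pi.zero_apply] at this
          rw [this, mul_zero]
        · simp only [shortTransfer, Matrix.of_apply, dif_neg h, zero_mul]
      · simp

end Transfer

/-! ### The public coins are generic with high probability -/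

section Generic

variable {V : Type*} {ne : ℕ} {p : Params} {F : Type*} [Field F]

/-- Finiteness makes union bounds over all networks possible, so the constants depend on neither the
environment nor q. -/
instance [Finite V] : Finite (Network V ne) :=
  Finite.of_injective (fun N : Network V ne => (N.tail, N.head)) fun N N' h => by
    cases N
    cases N'
    simpa using h

/-- Except for one value of the coefficient with which `e` feeds `e'`, the transfer vector of `e`
avoids the span of later transfer vectors if that of `e'` does. -/
theorem Network.transfer_coord (N : Network V ne) {alice bob : V} {f f' : Fin ne → Fin ne → F}
    {S : Finset (Fin ne)} {e e' : Fin ne} (hS : ∀ a ∈ S, e < a) (he : N.Feeds alice e e')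
    (hff : ∀ a a', (a, a') ≠ (e, e') → f a a' = f' a a')
    (h' : N.transfer alice bob f e' ∉ N.transferSpan alice bob f S)
    (h1 : N.transfer alice bob f e ∈ N.transferSpan alice bob f S)
    (h2 : N.transfer alice bob f' e ∈ N.transferSpan alice bob f' S) : f e e' = f' e e' := by
  classical
  have hlater : ∀ a, e < a → N.transfer alice bob f a = N.transfer alice bob f' a := fun a ha =>
    N.transfer_congr alice bob a fun a₁ h₁ a₂ => hff a₁ a₂ fun h =>
      (ha.trans_le h₁).ne' (Prod.ext_iff.1 h).1
  have hspan : N.transferSpan alice bob f' S = N.transferSpan alice bob f S := by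
    rw [transferSpan, transferSpan]
    congr 1
    exact Set.image_congr fun a ha => (hlater a (hS a ha)).symm
  rw [hspan] at h2
  have hsub : N.transfer alice bob f e - N.transfer alice bob f' e
      = (f e e' - f' e e') • N.transfer alice bob f e' := by
    rw [N.transfer_eq alice bob f e, N.transfer_eq alice bob f' e, add_sub_add_left_eq_sub,
      ← Finset.sum_sub_distrib, Finset.sum_eq_single e', if_pos he, if_pos he,
      ← hlater e' he.1, sub_smul]
    · intro a _ ha
      split_ifs with h
      · rw [hff e a fun h' => ha (Prod.ext_iff.1 h').2, hlater a h.1, sub_self]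
      · rw [sub_self]
    · simp
  by_contra hne
  have h3 := Submodule.sub_mem _ h1 h2
  rw [hsub] at h3
  exact h' ((Submodule.smul_mem_iff _ (sub_ne_zero.2 hne)).1 h3)

theorem measure_iUnion_le_card_mul {α I : Type*} [MeasurableSpace α] {μ : Measure α} [Finite I]
    {B : I → Set α} {r : ENNReal} (h : ∀ i, μ (B i) ≤ r) : μ (⋃ i, B i) ≤ Nat.card I * r := by
  have : Fintype I := Fintype.ofFinite I
  calc μ (⋃ i, B i) ≤ ∑ i, μ (B i) := measure_iUnion_fintype_le _ _
    _ ≤ ∑ _i : I, r := Finset.sum_le_sum fun i _ => h i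
    _ = _ := by simp

variable [Fintype F] [MeasurableSpace F] [DiscreteMeasurableSpace F] (alice bob : V)

/-- A coincidence for fixed stage, network, set S and pair e, e' pins down the single coefficient
from e to e', hence has probability at most 1/q. A union bound over all such data follows. -/
theorem uniformSymbols_not_longNode_generic_le [Finite V] (T : ℕ) :
    uniformSymbols (PubCoin p ne) F {pub | ¬ ∀ k < T, ∀ N : Network V ne,
        N.Generic alice bob (longNodeCoef pub k)}
      ≤ Nat.card (Fin T × Network V ne × Finset (Fin ne) × Fin ne × Fin ne)
        * (1 / Fintype.card F) := by
  refine le_trans (measure_mono fun pub hpub => ?_) (measure_iUnion_le_card_mul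
    (B := fun i : Fin T × Network V ne × Finset (Fin ne) × Fin ne × Fin ne =>
      {pub : PubCoin p ne → F | (∀ a ∈ i.2.2.1, i.2.2.2.1 < a) ∧
        i.2.1.Feeds alice i.2.2.2.1 i.2.2.2.2 ∧
        i.2.1.transfer alice bob (longNodeCoef pub i.1) i.2.2.2.2
          ∉ i.2.1.transferSpan alice bob (longNodeCoef pub i.1) i.2.2.1 ∧
        i.2.1.transfer alice bob (longNodeCoef pub i.1) i.2.2.2.1
          ∈ i.2.1.transferSpan alice bob (longNodeCoef pub i.1) i.2.2.1}) ?_)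
  · simp only [Set.mem_ofPred_eq, Network.Generic, not_forall, not_not] at hpub
    obtain ⟨k, hk, N, e, S, e', h1, h2, h3, h4⟩ := hpub
    exact Set.mem_iUnion.2 ⟨(⟨k, hk⟩, N, S, e, e'), h1, h2, h3, h4⟩
  · rintro ⟨k, N, S, e, e'⟩
    refine uniformSymbols_le_of_coord (measurableSet_of_finite_coords
      (fun a : Fin ne × Fin ne => PubCoin.longNode k a.1 a.2) fun x y hxy hx => ?_)
      (.longNode k e e') fun x y hxy hx hy => ?_
    · have : longNodeCoef x k = longNodeCoef y k := funext₂ fun a a' => hxy (a, a')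
      rw [Set.mem_ofPred_eq] at hx ⊢
      rwa [← this]
    · exact N.transfer_coord hx.1 hx.2.1 (fun a a' h => hxy _ fun h' => h (by
        injection h' with _ h1 h2
        rw [h1, h2])) hx.2.2.1 hx.2.2.2 hy.2.2.2

theorem uniformSymbols_not_shortNode_generic_le [Finite V] (T : ℕ) :
    uniformSymbols (PubCoin p ne) F {pub | ¬ ∀ k < T, ∀ N : Network V ne,
        N.Generic alice bob (shortNodeCoef pub k)}
      ≤ Nat.card (Fin T × Network V ne × Finset (Fin ne) × Fin ne × Fin ne)
        * (1 / Fintype.card F) := by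
  refine le_trans (measure_mono fun pub hpub => ?_) (measure_iUnion_le_card_mul
    (B := fun i : Fin T × Network V ne × Finset (Fin ne) × Fin ne × Fin ne =>
      {pub : PubCoin p ne → F | (∀ a ∈ i.2.2.1, i.2.2.2.1 < a) ∧
        i.2.1.Feeds alice i.2.2.2.1 i.2.2.2.2 ∧
        i.2.1.transfer alice bob (shortNodeCoef pub i.1) i.2.2.2.2
          ∉ i.2.1.transferSpan alice bob (shortNodeCoef pub i.1) i.2.2.1 ∧
        i.2.1.transfer alice bob (shortNodeCoef pub i.1) i.2.2.2.1
          ∈ i.2.1.transferSpan alice bob (shortNodeCoef pub i.1) i.2.2.1}) ?_)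
  · simp only [Set.mem_ofPred_eq, Network.Generic, not_forall, not_not] at hpub
    obtain ⟨k, hk, N, e, S, e', h1, h2, h3, h4⟩ := hpub
    exact Set.mem_iUnion.2 ⟨(⟨k, hk⟩, N, S, e, e'), h1, h2, h3, h4⟩
  · rintro ⟨k, N, S, e, e'⟩
    refine uniformSymbols_le_of_coord (measurableSet_of_finite_coords
      (fun a : Fin ne × Fin ne => PubCoin.shortNode k a.1 a.2) fun x y hxy hx => ?_)
      (.shortNode k e e') fun x y hxy hx hy => ?_
    · have : shortNodeCoef x k = shortNodeCoef y k := funext₂ fun a a' => hxy (a, a')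
      rw [Set.mem_ofPred_eq] at hx ⊢
      rwa [← this]
    · exact N.transfer_coord hx.1 hx.2.1 (fun a a' h => hxy _ fun h' => h (by
        injection h' with _ h1 h2
        rw [h1, h2])) hx.2.2.1 hx.2.2.2 hy.2.2.2

/-- Calvin chooses the attacked sets after seeing the coins, so the union runs over all sets instead
of conditioning on his choice. Each single event pins down one encoding coefficient. -/
theorem uniformSymbols_not_longGeneric_le [Finite V] (T : ℕ) :
    uniformSymbols (PubCoin p ne) F {pub | ¬ ∀ t ≤ T, ∀ (N : Fin t → Network V ne)
        (A : Fin t → Finset (Fin ne)), LongGeneric alice bob N A pub}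
      ≤ Nat.card (Σ t : Fin (T + 1), (Fin t → Network V ne) × (Fin t → Finset (Fin ne)) × Fin p.b ×
        (Fin t × Fin ne)) * (1 / Fintype.card F) := by
  refine le_trans (measure_mono fun pub hpub => ?_) (measure_iUnion_le_card_mul
    (B := fun i : Σ t : Fin (T + 1), (Fin t → Network V ne) × (Fin t → Finset (Fin ne)) × Fin p.b ×
        (Fin t × Fin ne) => {pub : PubCoin p ne → F |
      longGen alice bob i.2.1 pub i.2.2.2.2 ∉
        encodedBelow (longGen alice bob i.2.1 pub) (longCoef i.1 pub)
          (longErrSpan alice bob i.2.1 i.2.2.1 pub) i.2.2.2.1 ∧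
      encoded (longGen alice bob i.2.1 pub) (longCoef i.1 pub) i.2.2.2.1 ∈
        encodedBelow (longGen alice bob i.2.1 pub) (longCoef i.1 pub)
          (longErrSpan alice bob i.2.1 i.2.2.1 pub) i.2.2.2.1}) ?_)
  · simp only [Set.mem_ofPred_eq, LongGeneric, not_forall, not_not] at hpub
    obtain ⟨t, ht, N, A, s, x, h1, h2⟩ := hpub
    exact Set.mem_iUnion.2 ⟨⟨⟨t, Nat.lt_succ_of_le ht⟩, N, A, s, x⟩, h1, h2⟩
  · rintro ⟨t, N, A, s, k, e⟩
    -- Generators and error space depend on the node coefficients only, so they stay fixed when an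
    -- encoding coefficient varies.
    have hgen : ∀ x y : PubCoin p ne → F,
        (∀ (k : Fin t) a a', x (.longNode k a a') = y (.longNode k a a')) →
        longGen alice bob N x = longGen alice bob N y ∧
        longErrSpan alice bob N A x = longErrSpan alice bob N A y := by
      intro x y h
      have : ∀ k : Fin t, longNodeCoef x k = longNodeCoef y k := fun k => funext₂ (h k)
      constructor
      · funext z
        rw [longGen, longGen, this]
      · rw [longErrSpan, longErrSpan]
        simp only [this]
    refine uniformSymbols_le_of_coord (measurableSet_of_finite_coords
      (Sum.elim (fun a : Fin t × Fin ne × Fin ne => PubCoin.longNode a.1 a.2.1 a.2.2)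
        (fun a : Fin t × Fin ne × Fin p.b => PubCoin.longEnc a.1 a.2.1 a.2.2))
        fun x y hxy hx => ?_)
      (.longEnc k e s) fun x y hxy hx hy => ?_
    · obtain ⟨h1, h2⟩ := hgen x y fun k a a' => hxy (.inl (k, a, a'))
      have h3 : longCoef t x = longCoef t y := funext₂ fun z s => hxy (.inr (z.1, z.2, s))
      rw [Set.mem_ofPred_eq] at hx ⊢
      rwa [← h1, ← h2, ← h3]
    · obtain ⟨h1, h2⟩ := hgen x y fun k a a' => hxy _ (by simp)
      refine encoded_coord (k := (k, e)) (s := s) (c := longCoef t x) (c' := longCoef t y) ?_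
        hx.1 hx.2 (by rw [h1, h2]; exact hy.2)
      rintro ⟨k', e'⟩ s' hne
      refine hxy _ fun h' => hne ?_
      injection h' with h3 h4 h5
      exact Prod.ext (Prod.ext (Fin.ext h3) h4) h5

/-- Only the coefficients of the σ newest rows of L, the block `Fin.last k`, have to be generic;
they form the diagonal block of the stage. -/
theorem uniformSymbols_not_shortGeneric_le [Finite V] (T : ℕ) :
    uniformSymbols (PubCoin p ne) F {pub | ¬ ∀ k < T, ∀ (N : Network V ne)
        (A : Finset (Fin ne)), ShortGeneric alice bob N A pub k}
      ≤ Nat.card (Fin T × Network V ne × Finset (Fin ne) × Fin p.σ × Fin ne)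
        * (1 / Fintype.card F) := by
  refine le_trans (measure_mono fun pub hpub => ?_) (measure_iUnion_le_card_mul
    (B := fun i : Fin T × Network V ne × Finset (Fin ne) × Fin p.σ × Fin ne =>
      {pub : PubCoin p ne → F |
      i.2.1.sourceTransfer alice bob (shortNodeCoef pub i.1) i.2.2.2.2 ∉
        encodedBelow (i.2.1.sourceTransfer alice bob (shortNodeCoef pub i.1)) (shortCoef i.1 pub)
          (i.2.1.transferSpan alice bob (shortNodeCoef pub i.1) i.2.2.1) i.2.2.2.1 ∧
      encoded (i.2.1.sourceTransfer alice bob (shortNodeCoef pub i.1)) (shortCoef i.1 pub)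
          i.2.2.2.1 ∈
        encodedBelow (i.2.1.sourceTransfer alice bob (shortNodeCoef pub i.1)) (shortCoef i.1 pub)
          (i.2.1.transferSpan alice bob (shortNodeCoef pub i.1) i.2.2.1) i.2.2.2.1}) ?_)
  · simp only [Set.mem_ofPred_eq, ShortGeneric, not_forall, not_not] at hpub
    obtain ⟨k, hk, N, A, s, x, h1, h2⟩ := hpub
    exact Set.mem_iUnion.2 ⟨⟨⟨k, hk⟩, N, A, s, x⟩, h1, h2⟩
  · rintro ⟨k, N, A, s, e⟩
    refine uniformSymbols_le_of_coord (measurableSet_of_finite_coords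
      (Sum.elim (fun a : Fin ne × Fin ne => PubCoin.shortNode k a.1 a.2)
        (fun a : Fin ne × Fin p.σ => PubCoin.shortEnc k a.1 (Fin.last k, a.2)))
        fun x y hxy hx => ?_)
      (.shortEnc k e (Fin.last k, s)) fun x y hxy hx hy => ?_
    · have h1 : shortNodeCoef x k = shortNodeCoef y k := funext₂ fun a a' => hxy (.inl (a, a'))
      have h3 : shortCoef k x = shortCoef k y := funext₂ fun e s => hxy (.inr (e, s))
      rw [Set.mem_ofPred_eq] at hx ⊢
      rwa [← h1, ← h3]
    · have h1 : shortNodeCoef x k = shortNodeCoef y k := funext₂ fun a a' => hxy _ (by simp)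
      refine encoded_coord (k := e) (s := s) (c := shortCoef k x) (c' := shortCoef k y) ?_
        hx.1 hx.2 (by rw [h1]; exact hy.2)
      intro e' s' hne
      refine hxy _ fun h' => hne ?_
      injection h' with _ h4 h5
      exact Prod.ext h4 (Prod.ext_iff.1 h5).2

/-- The public coins do not cause any loss of rank in the first `T` stages, whatever the networks
and the attacked hyperedges are. -/
structure GenericCoins (T : ℕ) (pub : PubCoin p ne → F) : Prop where
  longNode : ∀ k < T, ∀ N : Network V ne, N.Generic alice bob (longNodeCoef pub k)
  shortNode : ∀ k < T, ∀ N : Network V ne, N.Generic alice bob (shortNodeCoef pub k)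
  long : ∀ t ≤ T, ∀ (N : Fin t → Network V ne) (A : Fin t → Finset (Fin ne)),
    LongGeneric alice bob N A pub
  short : ∀ k < T, ∀ (N : Network V ne) (A : Finset (Fin ne)), ShortGeneric alice bob N A pub k

/-- The number of coincidences that are excluded by `GenericCoins`. -/
noncomputable def coincidences (V : Type*) (ne : ℕ) (p : Params) (T : ℕ) : ℕ :=
  Nat.card (Fin T × Network V ne × Finset (Fin ne) × Fin ne × Fin ne)
  + Nat.card (Fin T × Network V ne × Finset (Fin ne) × Fin ne × Fin ne)
  + Nat.card (Σ t : Fin (T + 1), (Fin t → Network V ne) × (Fin t → Finset (Fin ne)) × Fin p.b ×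
        (Fin t × Fin ne))
  + Nat.card (Fin T × Network V ne × Finset (Fin ne) × Fin p.σ × Fin ne)

theorem uniformSymbols_not_genericCoins_le [Finite V] (T : ℕ) :
    uniformSymbols (PubCoin p ne) F {pub | ¬ GenericCoins alice bob T pub}
      ≤ coincidences V ne p T * (1 / Fintype.card F) := by
  have hsub : {pub : PubCoin p ne → F | ¬ GenericCoins alice bob T pub} ⊆
      {pub | ¬ ∀ k < T, ∀ N : Network V ne, N.Generic alice bob (longNodeCoef pub k)} ∪
      {pub | ¬ ∀ k < T, ∀ N : Network V ne, N.Generic alice bob (shortNodeCoef pub k)} ∪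
      {pub | ¬ ∀ t ≤ T, ∀ (N : Fin t → Network V ne) (A : Fin t → Finset (Fin ne)),
        LongGeneric alice bob N A pub} ∪
      {pub | ¬ ∀ k < T, ∀ (N : Network V ne) (A : Finset (Fin ne)),
        ShortGeneric alice bob N A pub k} := by
    intro pub hpub
    by_contra h
    simp only [Set.mem_union, Set.mem_ofPred_eq, not_or, not_not] at h
    exact hpub ⟨h.1.1.1, h.1.1.2, h.1.2, h.2⟩
  refine (measure_mono hsub).trans ((measure_union_le _ _).trans ?_)
  rw [coincidences, Nat.cast_add, Nat.cast_add, Nat.cast_add, add_mul, add_mul, add_mul]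
  refine add_le_add ((measure_union_le _ _).trans (add_le_add ((measure_union_le _ _).trans
    (add_le_add ?_ ?_)) ?_)) ?_
  · exact uniformSymbols_not_longNode_generic_le alice bob T
  · exact uniformSymbols_not_shortNode_generic_le alice bob T
  · exact uniformSymbols_not_longGeneric_le alice bob T
  · exact uniformSymbols_not_shortGeneric_le alice bob T

end Generic

/-! ### The parity checks exclude false solutions -/

section Parity

variable {p : Params} {ne : ℕ} {F : Type*} [Field F]

theorem hashRow_sub (d : F) (W W' : Message p F) :
    hashRow d W' - hashRow d W = hashRow d (W' - W) := by
  simp only [hashRow, ← Finset.sum_sub_distrib, ← mul_sub, Matrix.sub_apply]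

/-- The left side minus r is a nonzero polynomial in d of degree at most nb, so its roots bound the
solutions. -/
theorem ncard_hashRow_eq_le {Δ : Message p F} (hΔ : Δ ≠ 0) (r : F) :
    {d : F | hashRow d Δ = r}.ncard ≤ p.n * p.b := by
  classical
  let e : Fin p.n × Fin p.b ≃ Fin (p.n * p.b) := finProdFinEquiv
  let w : Fin (p.n * p.b) → F := fun i => Δ (e.symm i).2 (e.symm i).1
  let P : Polynomial F := ∑ i : Fin (p.n * p.b),
    Polynomial.C (w i) * Polynomial.X ^ ((i : ℕ) + 1) - Polynomial.C r
  have heval : ∀ d, P.eval d = hashRow d Δ - r := by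
    intro d
    simp only [P, Polynomial.eval_sub, Polynomial.eval_finsetSum, Polynomial.eval_mul,
      Polynomial.eval_C, Polynomial.eval_pow, Polynomial.eval_X]
    congr 1
    rw [hashRow, ← Fintype.sum_prod_type', ← e.sum_comp]
    refine Finset.sum_congr rfl fun x _ => ?_
    simp only [w, e.symm_apply_apply]
    have : ((e x : Fin (p.n * p.b)) : ℕ) = (x.1 : ℕ) * p.b + x.2 := by
      simp [e, finProdFinEquiv, add_comm, mul_comm]
    rw [this, mul_comm]
  have hdeg : P.natDegree ≤ p.n * p.b := by
    refine (Polynomial.natDegree_sub_le_of_le (m := p.n * p.b) (n := 0)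
      (Polynomial.natDegree_sum_le_of_forall_le _ _ fun i _ => ?_) (by simp)).trans (by simp)
    exact (Polynomial.natDegree_C_mul_X_pow_le _ _).trans i.2
  have hP : P ≠ 0 := by
    intro h0
    refine hΔ ?_
    ext s c
    -- The exponents start at 1, so the constant r cannot cancel a coefficient coming from Δ.
    have h1 : P.coeff ((e (c, s) : ℕ) + 1) = 0 := by rw [h0, Polynomial.coeff_zero]
    simp only [P, Polynomial.coeff_sub, Polynomial.finsetSum_coeff, Polynomial.coeff_C_mul_X_pow,
      Polynomial.coeff_C_succ, sub_zero, add_left_inj, Fin.val_inj] at h1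
    rw [Finset.sum_ite_eq, if_pos (Finset.mem_univ _)] at h1
    simpa [w] using h1
  calc {d : F | hashRow d Δ = r}.ncard ≤ (P.roots.toFinset : Set F).ncard := by
        refine Set.ncard_le_ncard (fun d hd => ?_) (Finset.finite_toSet _)
        have hd' : hashRow d Δ = r := hd
        simp [hP, Polynomial.IsRoot, heval, hd']
    _ ≤ p.n * p.b := by
        rw [Set.ncard_coe_finset]
        exact (Multiset.toFinset_card_le _).trans ((Polynomial.card_roots' P).trans hdeg)

/-- The position of a parity check of the first `t` stages among all parity checks. -/
def parityEmb (p : Params) (t : ℕ) : ParityUpTo p t ↪ SecretIdx p where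
  toFun j := ⟨j.1, j.2⟩
  inj' := by
    rintro ⟨⟨k, hk⟩, j⟩ ⟨⟨k', hk'⟩, j'⟩ h
    simp only [Sigma.mk.injEq] at h
    obtain ⟨rfl, h2⟩ := h
    simpa using h2

theorem two_mul_card_parityUpTo (p : Params) (t : ℕ) :
    2 * Fintype.card (ParityUpTo p t) = t * (t + 1) * (p.σ * p.m) := by
  have h1 : Fintype.card (ParityUpTo p t) = ∑ k : Fin t, ((k : ℕ) + 1) * p.m * p.σ := by
    simp [ParityUpTo, ParityIdx, ShortFront]
  rw [h1, Fin.sum_univ_eq_sum_range (fun k => (k + 1) * p.m * p.σ) t]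
  have h2 := Finset.sum_range_id_mul_two (t + 1)
  rw [Finset.sum_range_succ', add_zero, Nat.add_sub_cancel] at h2
  simp_rw [mul_assoc]
  rw [← Finset.sum_mul, ← mul_assoc, mul_comm 2, h2, mul_comm p.σ]
  ring

theorem shortFrontMatrix_injective (t : ℕ) :
    Function.Injective (shortFrontMatrix (p := p) (F := F) t) := by
  intro l l' h
  funext ⟨k, ⟨c, u⟩, s⟩
  have hc : (c : ℕ) < t := lt_of_lt_of_le c.2 k.2
  have := congrFun (congrFun h (k, s)) (⟨c, hc⟩, u)
  simpa [shortFrontMatrix, c.2] using this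

variable [Fintype F] [MeasurableSpace F] [DiscreteMeasurableSpace F]

/-- For fixed candidates every check involves its own independent symbol of d and holds with
probability at most nb/q; the probabilities multiply. -/
theorem uniformSymbols_parity_le (t : ℕ) {W W' : Message p F} (hW : W' ≠ W)
    (l : SecretIdx p → F) (l' : ParityUpTo p t → F) :
    uniformSymbols (SecretIdx p) F {d | ∀ j : ParityUpTo p t,
        hashRow (upTo t d j) W' + l' j = upTo t l j + hashRow (upTo t d j) W}
      ≤ (((p.n * p.b : ℕ) : ENNReal) / Fintype.card F) ^ Fintype.card (ParityUpTo p t) := by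
  classical
  -- The value 0 outside the first t stages is a filler; only earlier indices are constrained.
  let r : SecretIdx p → F := fun i => if h : i.1 < t then l i - l' ⟨⟨i.1, h⟩, i.2⟩ else 0
  have hsub : {d : SecretIdx p → F | ∀ j : ParityUpTo p t,
        hashRow (upTo t d j) W' + l' j = upTo t l j + hashRow (upTo t d j) W}
      ⊆ Set.pi ((Finset.univ.map (parityEmb p t) : Finset (SecretIdx p)) : Set (SecretIdx p))
        fun i => {x | hashRow x (W' - W) = r i} := by
    intro d hd i hi
    obtain ⟨j, -, rfl⟩ := Finset.mem_map.1 hi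
    have h1 : r (parityEmb p t j) = upTo t l j - l' j := dif_pos j.1.2
    have h2 : hashRow (upTo t d j) W' + l' j = upTo t l j + hashRow (upTo t d j) W := hd j
    show hashRow (upTo t d j) (W' - W) = r (parityEmb p t j)
    rw [h1, ← hashRow_sub]
    linear_combination h2
  refine (measure_mono hsub).trans ?_
  rw [Measure.infinitePi_pi _ fun i _ => .of_discrete]
  refine (Finset.prod_le_pow_card _ _ _ fun i _ =>
    uniform_apply_le (ncard_hashRow_eq_le (sub_ne_zero.2 hW) (r i))).trans (le_of_eq ?_)
  rw [Finset.card_map, Finset.card_univ]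

/-- The union bound over q^X candidates with P checks each: one check in excess of X leaves a factor
1/q. -/
theorem ennreal_pow_mul_div_pow_le {q X P : ℕ} (a : ENNReal) (hq : 1 ≤ q) (h : X + 1 ≤ P) :
    ((q ^ X : ℕ) : ENNReal) * (a / q) ^ P ≤ a ^ P * (1 / q) := by
  obtain ⟨r, rfl⟩ := Nat.exists_eq_add_of_le h
  have hq0 : (q : ENNReal) ≠ 0 := by positivity
  have hqt : (q : ENNReal) ≠ ⊤ := ENNReal.natCast_ne_top q
  have h1 : (q : ENNReal) * (q : ENNReal)⁻¹ = 1 := ENNReal.mul_inv_cancel hq0 hqt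
  have h2 : (q : ENNReal)⁻¹ ≤ 1 := ENNReal.inv_le_one.2 (by exact_mod_cast hq)
  rw [div_eq_mul_inv, mul_pow, one_div]
  calc ((q ^ X : ℕ) : ENNReal) * (a ^ (X + 1 + r) * (q : ENNReal)⁻¹ ^ (X + 1 + r))
      = a ^ (X + 1 + r) * ((q * (q : ENNReal)⁻¹) ^ X * (q : ENNReal)⁻¹ * (q : ENNReal)⁻¹ ^ r) := by
        push_cast
        ring
    _ ≤ a ^ (X + 1 + r) * (1 * (q : ENNReal)⁻¹ * 1) := by
        rw [h1, one_pow]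
        gcongr
        exact pow_le_one₀ (by positivity) h2
    _ = _ := by rw [one_mul, mul_one]

/-- The unknown dimensions are at most tbc + t²σc, quadratic in t because of the short packets. The
checks also grow quadratically, since stage k contributes kσm of them, and the choice of m makes
their leading coefficient large enough. -/
theorem candidates_lt_parityChecks {b σ m c t a a' P : ℕ} (ht : 1 ≤ t)
    (hm : 2 * b * c + 2 * σ * c + 1 ≤ σ * m) (ha : a ≤ t * c) (ha' : a' ≤ t * c)
    (hP : 2 * P = t * (t + 1) * (σ * m)) : b * a + t * σ * a' + 1 ≤ P := by
  have h1 : t * (t + 1) * (2 * b * c + 2 * σ * c + 1) ≤ t * (t + 1) * (σ * m) :=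
    Nat.mul_le_mul_left _ hm
  have h2 : b * a ≤ b * (t * c) := Nat.mul_le_mul_left _ ha
  have h3 : t * σ * a' ≤ t * σ * (t * c) := Nat.mul_le_mul_left _ ha'
  have h4 : t * t ≥ 1 := Nat.mul_pos ht ht
  have h5 : 0 ≤ t * t * (b * c) := Nat.zero_le _
  have h6 : 0 ≤ t * (σ * c) := Nat.zero_le _
  nlinarith

/-- Given everything that Calvin knows and what Bob has received, the parity checks leave a
solution other than the true one with small probability. -/
theorem uniformSymbols_false_solution_le {t c : ℕ} (ht : 1 ≤ t)
    (hm : 2 * p.b * c + 2 * p.σ * c + 1 ≤ p.σ * p.m)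
    {Y : Matrix (Fin t × Fin ne) (LongCol p) F} {J : Matrix (Fin t × Fin ne) (ShortCol p t) F}
    (ρ : Reduction Y) (ρ' : Reduction J) (hρ : ρ.a ≤ t * c) (hρ' : ρ'.a ≤ t * c)
    (W : Message p F) (l : SecretIdx p → F) :
    uniformSymbols (SecretIdx p) F {d | ∃ x ∈ solutions ρ ρ' d (fun j => l j + hashRow (d j) W),
        x ≠ (W, upTo t l)}
      ≤ ((p.n * p.b : ℕ) : ENNReal) ^ Fintype.card (ParityUpTo p t) * (1 / Fintype.card F) := by
  classical
  -- The candidate set does not involve d. Those with the true message are excluded, because the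
  -- checks then force the true parity symbols too.
  let cand : Finset (Message p F × (ParityUpTo p t → F)) :=
    Finset.univ.filter fun x => ρ.Match x.1 ∧ ρ'.Match (shortFrontMatrix t x.2) ∧ x.1 ≠ W
  have hsub : {d | ∃ x ∈ solutions ρ ρ' d (fun j => l j + hashRow (d j) W), x ≠ (W, upTo t l)}
      ⊆ ⋃ x ∈ cand, {d : SecretIdx p → F | ∀ j : ParityUpTo p t,
        hashRow (upTo t d j) x.1 + x.2 j = upTo t l j + hashRow (upTo t d j) W} := by
    rintro d ⟨x, ⟨h1, h2, h3⟩, hne⟩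
    have h3' : ∀ j : ParityUpTo p t,
      hashRow (upTo t d j) x.1 + x.2 j = upTo t l j + hashRow (upTo t d j) W := h3
    refine Set.mem_iUnion₂.2 ⟨x, Finset.mem_filter.2 ⟨Finset.mem_univ _, h1, h2, fun hW => ?_⟩, h3'⟩
    refine hne (Prod.ext hW (funext fun j => ?_))
    have := h3' j
    rw [hW] at this
    linear_combination this
  have hcard : cand.card ≤ Fintype.card F ^ (p.b * ρ.a + t * p.σ * ρ'.a) := by
    have h1 := ρ.ncard_match_le
    have h2 := ρ'.ncard_match_le
    rw [Fintype.card_fin] at h1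
    rw [Fintype.card_prod, Fintype.card_fin, Fintype.card_fin] at h2
    have h3 : {l' : ParityUpTo p t → F | ρ'.Match (shortFrontMatrix t l')}.ncard
        ≤ {U | ρ'.Match U}.ncard :=
      Set.ncard_le_ncard_of_injOn (shortFrontMatrix t) (fun _ h => h)
        (shortFrontMatrix_injective t).injOn (Set.toFinite _)
    calc cand.card = (cand : Set (Message p F × (ParityUpTo p t → F))).ncard :=
          (Set.ncard_coe_finset _).symm
      _ ≤ ({U | ρ.Match U} ×ˢ {l' : ParityUpTo p t → F |
            ρ'.Match (shortFrontMatrix t l')}).ncard := by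
          refine Set.ncard_le_ncard (fun x hx => ?_) (Set.toFinite _)
          have := (Finset.mem_filter.1 hx).2
          exact ⟨this.1, this.2.1⟩
      _ ≤ _ := by
          rw [Set.ncard_prod, pow_add]
          exact Nat.mul_le_mul h1 (h3.trans h2)
  calc _ ≤ _ := measure_mono hsub
    _ ≤ ∑ x ∈ cand, _ := measure_biUnion_finset_le _ _
    _ ≤ ∑ _x ∈ cand, (((p.n * p.b : ℕ) : ENNReal) / Fintype.card F)
          ^ Fintype.card (ParityUpTo p t) :=
        Finset.sum_le_sum fun x hx => uniformSymbols_parity_le t (Finset.mem_filter.1 hx).2.2.2 l x.2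
    _ = cand.card * (((p.n * p.b : ℕ) : ENNReal) / Fintype.card F)
          ^ Fintype.card (ParityUpTo p t) := by rw [Finset.sum_const, nsmul_eq_mul]
    _ ≤ ((Fintype.card F ^ (p.b * ρ.a + t * p.σ * ρ'.a) : ℕ) : ENNReal)
          * (((p.n * p.b : ℕ) : ENNReal) / Fintype.card F) ^ Fintype.card (ParityUpTo p t) := by
        gcongr
    _ ≤ _ := ennreal_pow_mul_div_pow_le _ Fintype.card_pos
        (candidates_lt_parityChecks ht hm hρ hρ' (two_mul_card_parityUpTo p t))

end Parity

/-! ### The session -/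

section Discrete

variable {V : Type*} {ne : ℕ} {p : Params} {F : Type*}

instance : DiscreteMeasurableSpace (Network V ne) := ⟨fun _ => trivial⟩

instance {k : ℕ} : DiscreteMeasurableSpace (Attack p ne F k) := ⟨fun _ => trivial⟩

instance [Finite F] {k : ℕ} : Finite (Attack p ne F k) :=
  Finite.of_injective (fun a : Attack p ne F k => (a.longSet, a.longErr, a.shortSet, a.shortErr))
    fun a a' h => by
      cases a
      cases a'
      simpa using h

end Discrete

namespace Environment

variable {Ω V : Type*} {ne : ℕ} (S : Environment Ω V ne)

theorem M_le_of_card_out_le {c : ℕ} (hc : ∀ k ω, ((S.longNet k ω).out S.alice).card ≤ c) (k : ℕ)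
    (ω : Ω) : S.M k ω ≤ c :=
  ((S.longNet k ω).capacity_le_card_out S.alice S.bob).trans (hc k ω)

theorem cutTime_eq_passageTime (hz : ∀ k ω, S.z k ω ≤ S.M k ω) (b : ℕ) (ω : Ω) :
    S.cutTime b ω = passageTime b fun k => S.M k ω - S.z k ω := by
  rw [cutTime, passageTime]
  congr 1
  ext t
  have h : ∑ k ∈ Finset.range t, (S.M k ω - S.z k ω) + ∑ k ∈ Finset.range t, S.z k ω
      = ∑ k ∈ Finset.range t, S.M k ω := by
    rw [← Finset.sum_add_distrib]
    exact Finset.sum_congr rfl fun k _ => Nat.sub_add_cancel (hz k ω)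
  show b + _ ≤ _ ↔ b ≤ _
  omega

theorem cutTime_le {b t : ℕ} {ω : Ω}
    (h : b + ∑ k ∈ Finset.range t, S.z k ω ≤ ∑ k ∈ Finset.range t, S.M k ω) :
    S.cutTime b ω ≤ t :=
  Nat.sInf_le (show t ∈ {t | b + ∑ k ∈ Finset.range t, S.z k ω ≤ ∑ k ∈ Finset.range t, S.M k ω}
    from h)

theorem cutTime_spec {b t : ℕ} {ω : Ω}
    (h : b + ∑ k ∈ Finset.range t, S.z k ω ≤ ∑ k ∈ Finset.range t, S.M k ω) :
    b + ∑ k ∈ Finset.range (S.cutTime b ω), S.z k ω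
      ≤ ∑ k ∈ Finset.range (S.cutTime b ω), S.M k ω :=
  Nat.sInf_mem (s := {t | b + ∑ k ∈ Finset.range t, S.z k ω ≤ ∑ k ∈ Finset.range t, S.M k ω})
    ⟨t, h⟩

variable {p : Params} {F : Type*} [Field F] [MeasurableSpace Ω] [MeasurableSpace F]

/-- The long packets of `t` stages, as a function of all that Calvin knows. -/
noncomputable def recvLong (W : Message p F) (A : S.Calvin p F) (t : ℕ)
    (y : Ω × (PubCoin p ne → F) × (SecretIdx p → F)) :
    Matrix (Fin t × Fin ne) (LongCol p) F :=
  stackLong t fun k => longStage S.alice S.bob (S.longNet k y.1) W y.2.1 k (A.act k y)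

/-- The short packets of `t` stages, as a function of all that Calvin knows. -/
noncomputable def recvShort (A : S.Calvin p F) (t : ℕ)
    (y : Ω × (PubCoin p ne → F) × (SecretIdx p → F)) :
    Matrix (Fin t × Fin ne) (ShortCol p t) F :=
  stackShort t fun k => shortStage S.alice S.bob (S.shortNet k y.1) y.2.2 y.2.1 k (A.act k y)

/-- Some solution of Bob's equations is not the true one `(W, l)`. -/
def HasFalseSolution (B : BasisRule p ne F) (W : Message p F) (t : ℕ)
    (Y : Matrix (Fin t × Fin ne) (LongCol p) F) (J : Matrix (Fin t × Fin ne) (ShortCol p t) F)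
    (d l : ParityUpTo p t → F) : Prop :=
  ∃ hb : Nonempty (Reduction Y) ∧ Nonempty (Reduction J), ∃ s : Message p F × (ParityUpTo p t → F),
    (B.long t Y hb.1).Match s.1 ∧ (B.short t J hb.2).Match (shortFrontMatrix t s.2) ∧
    (∀ j, hashRow (d j) s.1 + s.2 j = l j + hashRow (d j) W) ∧ s ≠ (W, l)

/-- The indices of the public coins of the first `t` stages. -/
abbrev CoinsUpTo (p : Params) (ne t : ℕ) :=
  ((Fin t × Fin ne × Fin p.b) ⊕ (Fin t × Fin ne × Fin ne)) ⊕
    ((Σ k : Fin t, Fin ne × ShortRear p (k + 1)) ⊕ (Fin t × Fin ne × Fin ne))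

/-- The public coin with a given index. -/
def coinUpTo {t : ℕ} : CoinsUpTo p ne t → PubCoin p ne :=
  Sum.elim (Sum.elim (fun i => .longEnc i.1 i.2.1 i.2.2) fun i => .longNode i.1 i.2.1 i.2.2)
    (Sum.elim (fun i => .shortEnc i.1 i.2.1 i.2.2) fun i => .shortNode i.1 i.2.1 i.2.2)

variable {S}

theorem recvLong_congr {W : Message p F} {A : S.Calvin p F} {t : ℕ}
    {y y' : Ω × (PubCoin p ne → F) × (SecretIdx p → F)}
    (hN : ∀ k : Fin t, S.longNet k y.1 = S.longNet k y'.1)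
    (hpub : ∀ i : CoinsUpTo p ne t, y.2.1 (coinUpTo i) = y'.2.1 (coinUpTo i))
    (hA : ∀ k : Fin t, A.act k y = A.act k y') : S.recvLong W A t y = S.recvLong W A t y' := by
  ext ⟨k, r⟩ c
  simp only [recvLong, stackLong, longStage, hN, hA]
  have h1 : ∀ e s, y.2.1 (.longEnc k e s) = y'.2.1 (.longEnc k e s) := fun e s =>
    hpub (.inl (.inl (k, e, s)))
  have h2 : ∀ e e', y.2.1 (.longNode k e e') = y'.2.1 (.longNode k e e') := fun e e' =>
    hpub (.inl (.inr (k, e, e')))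
  simp only [h1, h2]

theorem recvShort_congr {A : S.Calvin p F} {t : ℕ}
    {y y' : Ω × (PubCoin p ne → F) × (SecretIdx p → F)}
    (hN : ∀ k : Fin t, S.shortNet k y.1 = S.shortNet k y'.1)
    (hpub : ∀ i : CoinsUpTo p ne t, y.2.1 (coinUpTo i) = y'.2.1 (coinUpTo i))
    (hl : upTo t y.2.2 = upTo t y'.2.2)
    (hA : ∀ k : Fin t, A.act k y = A.act k y') : S.recvShort A t y = S.recvShort A t y' := by
  have hJ : ∀ k : Fin t, shortStage S.alice S.bob (S.shortNet k y.1) y.2.2 y.2.1 k (A.act k y)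
      = shortStage S.alice S.bob (S.shortNet k y'.1) y'.2.2 y'.2.1 k (A.act k y') := by
    intro k
    have h1 : ∀ e s, y.2.1 (.shortEnc k e s) = y'.2.1 (.shortEnc k e s) := fun e s =>
      hpub (.inr (.inl ⟨k, e, s⟩))
    have h2 : ∀ e e', y.2.1 (.shortNode k e e') = y'.2.1 (.shortNode k e e') := fun e e' =>
      hpub (.inr (.inr (k, e, e')))
    have h3 : shortSource ((k : ℕ) + 1) y.2.2 = shortSource ((k : ℕ) + 1) y'.2.2 := by
      rw [shortSource, shortSource]
      congr 2
      funext j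
      exact congrFun hl ⟨⟨j.1, j.1.2.trans_le k.2⟩, j.2⟩
    simp only [shortStage, hN, hA, h1, h2, h3]
  ext ⟨k, r⟩ c
  simp only [recvShort, stackShort, hJ]

/-- The event is a function of finitely many discrete observables of the first t stages. In this
sample point the third slot stands for l and the fourth for d, the coordinates produced by
`measurePreserving_parity`. -/
theorem measurableSet_hasFalseSolution [Finite V] [Finite F] [DiscreteMeasurableSpace F]
    (hlong : ∀ k, Measurable (S.longNet k)) (hshort : ∀ k, Measurable (S.shortNet k))
    (B : BasisRule p ne F) (W : Message p F) (A : S.Calvin p F) (t : ℕ) :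
    MeasurableSet {x : Sample Ω p ne F | HasFalseSolution B W t
      (S.recvLong W A t (x.1, x.2.1, x.2.2.1)) (S.recvShort A t (x.1, x.2.1, x.2.2.1))
      (upTo t x.2.2.2) (upTo t x.2.2.1)} := by
  let Φ : Sample Ω p ne F → ((∀ _ : Fin t, Network V ne) × (∀ _ : Fin t, Network V ne) ×
      (CoinsUpTo p ne t → F) × (∀ k : Fin t, Attack p ne F k) × (ParityUpTo p t → F) ×
      (ParityUpTo p t → F)) := fun x =>
    (fun k => S.longNet k x.1, fun k => S.shortNet k x.1, fun i => x.2.1 (coinUpTo i),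
      fun k => A.act k (x.1, x.2.1, x.2.2.1), upTo t x.2.2.2, upTo t x.2.2.1)
  have hup : Measurable (upTo (F := F) (p := p) t) := by
    unfold upTo
    fun_prop
  have hΦ : Measurable Φ := by
    refine Measurable.prodMk (measurable_pi_iff.2 fun k => (hlong k).comp measurable_fst)
      (Measurable.prodMk (measurable_pi_iff.2 fun k => (hshort k).comp measurable_fst)
      (Measurable.prodMk (by fun_prop)
      (Measurable.prodMk (measurable_pi_iff.2 fun k => (A.measurable_act k).comp (by fun_prop))
      (Measurable.prodMk (hup.comp (by fun_prop)) (hup.comp (by fun_prop))))))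
  have : Countable (∀ k : Fin t, Attack p ne F k) := inferInstance
  have : Countable (CoinsUpTo p ne t → F) := inferInstance
  have : Countable (ParityUpTo p t → F) := inferInstance
  have : Countable (Fin t → Network V ne) := inferInstance
  have : MeasurableSingletonClass (∀ k : Fin t, Attack p ne F k) := inferInstance
  have : MeasurableSingletonClass (CoinsUpTo p ne t → F) := inferInstance
  have : MeasurableSingletonClass (ParityUpTo p t → F) := inferInstance
  have : MeasurableSingletonClass (Fin t → Network V ne) := inferInstance
  refine measurableSet_of_finite_dependence hΦ fun x x' hxx hx => ?_
  simp only [Φ, Prod.mk.injEq] at hxx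
  obtain ⟨h1, h2, h3, h4, h5, h6⟩ := hxx
  have e1 := recvLong_congr (S := S) (W := W) (A := A) (y := (x.1, x.2.1, x.2.2.1))
    (y' := (x'.1, x'.2.1, x'.2.2.1)) (congrFun h1) (congrFun h3) (congrFun h4)
  have e2 := recvShort_congr (S := S) (A := A) (y := (x.1, x.2.1, x.2.2.1))
    (y' := (x'.1, x'.2.1, x'.2.2.1)) (congrFun h2) (congrFun h3) h6 (congrFun h4)
  rw [Set.mem_ofPred_eq] at hx ⊢
  rwa [← e1, ← e2, ← h5, ← h6]

/-! ### Dimension bounds for the attacks and correctness of a session -/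

section Bounds

variable {c : ℕ} (hc : ∀ k ω, ((S.longNet k ω).out S.alice).card ≤ c)
  (hcbar : ∀ k ω, ((S.shortNet k ω).out S.alice).card ≤ c)
  (hz : ∀ k ω, S.z k ω ≤ S.M k ω) (hσ : ∀ k ω, p.σ + S.zbar k ω ≤ S.Mbar k ω)

include hc hz in
theorem long_reduction_a_le (W : Message p F) (A : S.Calvin p F) (t : ℕ)
    (y : Ω × (PubCoin p ne → F) × (SecretIdx p → F)) (ρ : Reduction (S.recvLong W A t y)) :
    ρ.a ≤ t * c := by
  refine (ρ.a_le_finrank (longStage_residual_mem S.alice S.bob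
    (fun k : Fin t => S.longNet k y.1) W y.2.1 (fun k => A.act k y) _ fun _ => rfl)).trans
    ((finrank_longErrSpan_le _ _ _ _ _).trans ?_)
  calc _ ≤ ∑ _k : Fin t, c := Finset.sum_le_sum fun k _ =>
        (A.long_le k y).trans ((hz k y.1).trans (S.M_le_of_card_out_le hc k y.1))
    _ = t * c := by simp

include hcbar hσ in
theorem short_reduction_a_le (A : S.Calvin p F) (t : ℕ)
    (y : Ω × (PubCoin p ne → F) × (SecretIdx p → F)) (ρ : Reduction (S.recvShort A t y)) :
    ρ.a ≤ t * c := by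
  refine (ρ.a_le_finrank (shortStage_residual_mem S.alice S.bob
    (fun k : Fin t => S.shortNet k y.1) y.2.2 y.2.1 (fun k => A.act k y) _ fun _ => rfl)).trans
    ((finrank_shortErrSpan_le _ _ _ _ _).trans ?_)
  calc _ ≤ ∑ _k : Fin t, c := Finset.sum_le_sum fun k _ =>
        (A.short_le k y).trans (((Nat.le_add_left _ _).trans (hσ k y.1)).trans
          (((S.shortNet k y.1).capacity_le_card_out S.alice S.bob).trans (hcbar k y.1)))
    _ = t * c := by simp

/-- Replacing the secrets `h` by the redundancy `l` does not change the law. -/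
theorem measurePreserving_parity [Fintype F] [DiscreteMeasurableSpace F] (μ : Measure Ω)
    [IsProbabilityMeasure μ] (W : Message p F) :
    MeasurePreserving (fun x : Sample Ω p ne F => (x.1, x.2.1, parity W x.2.2.1 x.2.2.2, x.2.2.1))
      (law μ p ne F) (law μ p ne F) := by
  have hm : Measurable fun x : (SecretIdx p → F) × (SecretIdx p → F) => parity W x.1 x.2 := by
    refine measurable_pi_iff.2 fun j => ?_
    exact (Measurable.of_discrete (f := fun z : F × F => z.2 - hashRow z.1 W)).comp
      (g := fun z : F × F => z.2 - hashRow z.1 W)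
      (f := fun x : (SecretIdx p → F) × (SecretIdx p → F) => (x.1 j, x.2 j)) (by fun_prop)
  -- For each fixed d the map h ↦ h - Dw is a translation, so l is uniform and independent of d.
  have h1 : MeasurePreserving
      (fun x : (SecretIdx p → F) × (SecretIdx p → F) => (x.1, parity W x.1 x.2))
      ((uniformSymbols (SecretIdx p) F).prod (uniformSymbols (SecretIdx p) F))
      ((uniformSymbols (SecretIdx p) F).prod (uniformSymbols (SecretIdx p) F)) :=
    (MeasurePreserving.id _).skew_product (g := fun d h => parity W d h) hm
      (ae_of_all _ fun d => uniformSymbols_map_sub fun j => hashRow (d j) W)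
  exact (MeasurePreserving.id μ).prod ((MeasurePreserving.id _).prod
    (Measure.measurePreserving_swap.comp h1))

-- In the coordinates (l, d) the attacks, the received matrices and Bob's bases are functions of the
-- environment, the coins and l. Freezing these leaves d uniform, and the bound for fixed reductions
-- applies.
include hc hcbar hz hσ in
theorem law_hasFalseSolution_le [Finite V] [Fintype F] [DiscreteMeasurableSpace F] (μ : Measure Ω)
    [IsProbabilityMeasure μ]
    (hlong : ∀ k, Measurable (S.longNet k)) (hshort : ∀ k, Measurable (S.shortNet k))
    (hm : 2 * p.b * c + 2 * p.σ * c + 1 ≤ p.σ * p.m)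
    (B : BasisRule p ne F) (W : Message p F) (A : S.Calvin p F) {t : ℕ} (ht : 1 ≤ t) :
    law μ p ne F {x | HasFalseSolution B W t
        (S.recvLong W A t (x.1, x.2.1, parity W x.2.2.1 x.2.2.2))
        (S.recvShort A t (x.1, x.2.1, parity W x.2.2.1 x.2.2.2))
        (upTo t x.2.2.1) (upTo t (parity W x.2.2.1 x.2.2.2))}
      ≤ ((p.n * p.b : ℕ) : ENNReal) ^ Fintype.card (ParityUpTo p t) * (1 / Fintype.card F) := by
  have hmeas := measurableSet_hasFalseSolution hlong hshort B W A t
  refine le_trans (le_of_eq ((measurePreserving_parity μ W).measure_preimage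
    hmeas.nullMeasurableSet)) ?_
  refine prod_apply_le_of_section hmeas fun ω => ?_
  refine prod_apply_le_of_section (measurable_prodMk_left hmeas) fun pub => ?_
  refine prod_apply_le_of_section (measurable_prodMk_left (measurable_prodMk_left hmeas))
    fun l => ?_
  by_cases hb : Nonempty (Reduction (S.recvLong W A t (ω, pub, l))) ∧
      Nonempty (Reduction (S.recvShort A t (ω, pub, l)))
  · refine le_trans (measure_mono ?_) (uniformSymbols_false_solution_le ht hm
      (B.long t _ hb.1) (B.short t _ hb.2) (long_reduction_a_le hc hz W A t _ _)
      (short_reduction_a_le hcbar hσ A t _ _) W l)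
    rintro d ⟨_, s, h1, h2, h3, h4⟩
    exact ⟨s, ⟨h1, h2, h3⟩, h4⟩
  · refine le_trans (le_of_eq ?_) (zero_le (a := _))
    refine measure_mono_null (t := ∅) ?_ measure_empty
    rintro d ⟨hb', -⟩
    exact absurd hb' hb

/-- Without false solutions the solution set is empty or consists of the truth alone, whether or not
the coins are generic. This protects Bob when he stops before the cut time. -/
theorem outcome_eq_wait_or_decoded (hb : 1 ≤ p.b) (B : BasisRule p ne F) (W : Message p F)
    (A : S.Calvin p F) (x : Sample Ω p ne F) (t : ℕ)
    (hfalse : 1 ≤ t → ¬ HasFalseSolution B W t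
        (S.recvLong W A t (x.1, x.2.1, parity W x.2.2.1 x.2.2.2))
        (S.recvShort A t (x.1, x.2.1, parity W x.2.2.1 x.2.2.2))
        (upTo t x.2.2.1) (upTo t (parity W x.2.2.1 x.2.2.2))) :
    S.outcome B W A x t = .wait ∨ S.outcome B W A x t = .decoded W := by
  set y := (x.1, x.2.1, parity W x.2.2.1 x.2.2.2) with hy
  have hout : S.outcome B W A x t
      = decode B t (S.recvLong W A t y) (S.recvShort A t y) x.2.2.1 x.2.2.2 := rfl
  rw [hout, decode]
  by_cases h : Nonempty (Reduction (S.recvLong W A t y)) ∧ Nonempty (Reduction (S.recvShort A t y))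
  swap
  · exact Or.inl (dif_neg h)
  rw [dif_pos h]
  -- After zero stages the received matrix has rank 0 and cannot contain b independent rear columns.
  have ht : 1 ≤ t := by
    rcases Nat.eq_zero_or_pos t with rfl | ht
    · obtain ⟨⟨ρ⟩, -⟩ := h
      have h1 := ρ.rank_eq
      have h2 := Matrix.rank_le_card_height (S.recvLong W A 0 y)
      simp at h1 h2
      omega
    · exact ht
  have huniq : ∀ s ∈ solutions (B.long t _ h.1) (B.short t _ h.2) x.2.2.1 x.2.2.2,
      s = (W, upTo t (parity W x.2.2.1 x.2.2.2)) := by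
    rintro s ⟨h1, h2, h3⟩
    by_contra hne
    refine hfalse ht ⟨h, s, h1, h2, fun j => (h3 j).trans ?_, hne⟩
    simp [upTo, parity]
  split_ifs with h1 h2
  · exact Or.inl rfl
  · refine Or.inr ?_
    have h3 := huniq h2.choose ((Set.ext_iff.1 h2.choose_spec _).2 rfl)
    rw [h3]
  · obtain ⟨s, hs⟩ := Set.nonempty_iff_ne_empty.2 h1
    refine absurd ⟨s, ?_⟩ h2
    ext s'
    exact ⟨fun hs' => (huniq s' hs').trans (huniq s hs).symm, fun hs' => hs' ▸ hs⟩

-- Injectivity modulo the errors provides the bases and makes the true pair a solution, so Bob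
-- cannot be waiting.
include hσ in
theorem outcome_ne_wait (B : BasisRule p ne F) (W : Message p F) (A : S.Calvin p F)
    (x : Sample Ω p ne F) {t T : ℕ} (ht : t ≤ T) (hgen : GenericCoins S.alice S.bob T x.2.1)
    (hcut : p.b + ∑ k ∈ Finset.range t, S.z k x.1 ≤ ∑ k ∈ Finset.range t, S.M k x.1) :
    S.outcome B W A x t ≠ .wait := by
  set y := (x.1, x.2.1, parity W x.2.2.1 x.2.2.2) with hy
  have hout : S.outcome B W A x t
      = decode B t (S.recvLong W A t y) (S.recvShort A t y) x.2.2.1 x.2.2.2 := rfl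
  have hY := longStage_residual_mem S.alice S.bob (fun k : Fin t => S.longNet k y.1) W y.2.1
    (fun k => A.act k y)
    (fun k => longStage S.alice S.bob (S.longNet k y.1) W y.2.1 k (A.act k y)) fun _ => rfl
  have hJ := shortStage_residual_mem S.alice S.bob (fun k : Fin t => S.shortNet k y.1) y.2.2 y.2.1
    (fun k => A.act k y)
    (fun k => shortStage S.alice S.bob (S.shortNet k y.1) y.2.2 y.2.1 k (A.act k y)) fun _ => rfl
  have hT := longTransfer_injective_mod S.alice S.bob (N := fun k : Fin t => S.longNet k y.1)
    (A := fun k => (A.act k y).longSet) (fun k => hgen.longNode k (k.2.trans_le ht) _)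
    (hgen.long t ht _ _) (by
      rw [Finset.sum_range, Finset.sum_range] at hcut
      exact (Nat.add_le_add_left (Finset.sum_le_sum fun (k : Fin t) _ => A.long_le k y) _).trans
        hcut)
  have hT' := shortTransfer_injective_mod S.alice S.bob (N := fun k : Fin t => S.shortNet k y.1)
    (A := fun k => (A.act k y).shortSet) (fun k => hgen.shortNode k (k.2.trans_le ht) _)
    (fun k => hgen.short k (k.2.trans_le ht) _ _)
    (fun k => (Nat.add_le_add_left (A.short_le k y) _).trans (hσ k y.1))
  have h : Nonempty (Reduction (S.recvLong W A t y)) ∧ Nonempty (Reduction (S.recvShort A t y)) :=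
    ⟨nonempty_reduction_of_injective_mod hY hT, nonempty_reduction_of_injective_mod hJ hT'⟩
  rw [hout, decode, dif_pos h]
  have hmem : (W, upTo t y.2.2) ∈
      solutions (B.long t _ h.1) (B.short t _ h.2) x.2.2.1 x.2.2.2 :=
    ⟨Reduction.match_of_injective_mod _ hY hT, Reduction.match_of_injective_mod _ hJ hT',
      fun j => by simp [upTo, parity, hy]⟩
  rw [if_neg (Set.nonempty_iff_ne_empty.1 ⟨_, hmem⟩)]
  split_ifs <;> simp

include hσ in
theorem correct_of_generic (hb : 1 ≤ p.b) (B : BasisRule p ne F) (W : Message p F)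
    (A : S.Calvin p F) (x : Sample Ω p ne F) {T : ℕ}
    (hgen : GenericCoins S.alice S.bob T x.2.1)
    (hcut : ∃ t ≤ T, p.b + ∑ k ∈ Finset.range t, S.z k x.1 ≤ ∑ k ∈ Finset.range t, S.M k x.1)
    (hfalse : ∀ t, 1 ≤ t → t ≤ T → ¬ HasFalseSolution B W t
        (S.recvLong W A t (x.1, x.2.1, parity W x.2.2.1 x.2.2.2))
        (S.recvShort A t (x.1, x.2.1, parity W x.2.2.1 x.2.2.2))
        (upTo t x.2.2.1) (upTo t (parity W x.2.2.1 x.2.2.2))) :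
    S.Correct B W A x ∧ S.stopTime B W A x ≤ S.cutTime p.b x.1 := by
  obtain ⟨t, htT, ht⟩ := hcut
  have h1 : S.cutTime p.b x.1 ≤ T := (S.cutTime_le ht).trans htT
  have h2 := outcome_ne_wait hσ B W A x h1 hgen (S.cutTime_spec ht)
  have h3 : S.stopTime B W A x ≤ S.cutTime p.b x.1 :=
    Nat.sInf_le (show _ ∈ {t | S.outcome B W A x t ≠ .wait} from h2)
  have h4 : S.outcome B W A x (S.stopTime B W A x) ≠ .wait :=
    Nat.sInf_mem (s := {t | S.outcome B W A x t ≠ .wait}) ⟨_, h2⟩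
  exact ⟨(outcome_eq_wait_or_decoded hb B W A x _ fun h =>
    hfalse _ h (h3.trans h1)).resolve_left h4, h3⟩

theorem le_sessionRate (hb : 1 ≤ p.b) (B : BasisRule p ne F) (W : Message p F)
    (A : S.Calvin p F) {x : Sample Ω p ne F} (h : S.Correct B W A x)
    (hle : S.stopTime B W A x ≤ S.cutTime p.b x.1) :
    (p.b : ℝ) / S.cutTime p.b x.1 ≤ S.sessionRate B W A x := by
  -- It remains to compare reciprocals, which needs a positive stopping time: at t = 0 the required
  -- bases do not exist.
  rw [sessionRate, if_pos h]
  have h0 : 0 < S.stopTime B W A x := by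
    refine Nat.pos_of_ne_zero fun h0 => ?_
    have h1 : S.outcome B W A x (S.stopTime B W A x) = .decoded W := h
    rw [h0, show S.outcome B W A x 0 = decode B 0 _ _ x.2.2.1 x.2.2.2 from rfl, decode,
      dif_neg] at h1
    · cases h1
    · rintro ⟨⟨ρ⟩, -⟩
      have h1 := ρ.rank_eq
      have h2 := Matrix.rank_le_card_height (stackLong 0 fun k =>
        longStage S.alice S.bob (S.longNet k x.1) W x.2.1 k (S.attack W A x k))
      simp at h1 h2
      omega
  gcongr

end Bounds

end Environment

/-! ### Total error probability and expected session rate -/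

namespace Environment

section Main

variable {Ω V : Type*} {ne : ℕ} {S : Environment Ω V ne} {p : Params} [MeasurableSpace Ω]

/-- The union bound for the coincidences of the coding coefficients and for the false solutions
in the first `T` stages is this number divided by `q`. -/
noncomputable def errorCount (V : Type*) (ne : ℕ) (p : Params) (T : ℕ) : ℕ :=
  coincidences V ne p T + ∑ t ∈ Finset.Icc 1 T, (p.n * p.b) ^ Fintype.card (ParityUpTo p t)

/-- Failure requires one of three events: the walk is still below b at time T, some coincidence
occurs up to T, or some stage from 1 to T has a false solution. Only the last two depend on q. -/
theorem law_not_correct_le [Finite V] {F : Type*} [Field F] [Fintype F] [MeasurableSpace F]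
    [DiscreteMeasurableSpace F] {c : ℕ}
    (hc : ∀ k ω, ((S.longNet k ω).out S.alice).card ≤ c)
    (hcbar : ∀ k ω, ((S.shortNet k ω).out S.alice).card ≤ c)
    (hz : ∀ k ω, S.z k ω ≤ S.M k ω) (hσ : ∀ k ω, p.σ + S.zbar k ω ≤ S.Mbar k ω)
    (μ : Measure Ω) [IsProbabilityMeasure μ]
    (hlong : ∀ k, Measurable (S.longNet k)) (hshort : ∀ k, Measurable (S.shortNet k))
    (hb : 1 ≤ p.b) (hm : 2 * p.b * c + 2 * p.σ * c + 1 ≤ p.σ * p.m)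
    (B : BasisRule p ne F) (W : Message p F) (A : S.Calvin p F) (T : ℕ) :
    law μ p ne F {x | ¬ (S.Correct B W A x ∧ S.stopTime B W A x ≤ S.cutTime p.b x.1)}
      ≤ μ {ω | ∑ k ∈ Finset.range T, (S.M k ω - S.z k ω) < p.b}
        + errorCount V ne p T * (1 / Fintype.card F) := by
  have hsub : {x : Sample Ω p ne F |
        ¬ (S.Correct B W A x ∧ S.stopTime B W A x ≤ S.cutTime p.b x.1)} ⊆
      {ω | ∑ k ∈ Finset.range T, (S.M k ω - S.z k ω) < p.b} ×ˢ Set.univ ∪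
      (Set.univ ×ˢ ({pub | ¬ GenericCoins S.alice S.bob T pub} ×ˢ Set.univ) ∪
      ⋃ t ∈ Finset.Icc 1 T, {x | HasFalseSolution B W t
        (S.recvLong W A t (x.1, x.2.1, parity W x.2.2.1 x.2.2.2))
        (S.recvShort A t (x.1, x.2.1, parity W x.2.2.1 x.2.2.2))
        (upTo t x.2.2.1) (upTo t (parity W x.2.2.1 x.2.2.2))}) := by
    intro x hx
    by_contra hno
    simp only [Set.mem_union, Set.mem_prod, Set.mem_univ, Set.mem_ofPred_eq, and_true, true_and,
      Set.mem_iUnion, Finset.mem_Icc, not_or, not_lt, not_not, not_exists] at hno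
    obtain ⟨h1, h2, h3⟩ := hno
    refine hx (correct_of_generic hσ hb B W A x h2 ⟨T, le_rfl, ?_⟩ fun t ht ht' =>
      h3 t ⟨ht, ht'⟩)
    have h : ∑ k ∈ Finset.range T, (S.M k x.1 - S.z k x.1) + ∑ k ∈ Finset.range T, S.z k x.1
        = ∑ k ∈ Finset.range T, S.M k x.1 := by
      rw [← Finset.sum_add_distrib]
      exact Finset.sum_congr rfl fun k _ => Nat.sub_add_cancel (hz k x.1)
    omega
  refine (measure_mono hsub).trans ((measure_union_le _ _).trans (add_le_add ?_ ?_))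
  · rw [law, Measure.prod_prod, measure_univ, mul_one]
  · rw [errorCount, Nat.cast_add, add_mul]
    refine (measure_union_le _ _).trans (add_le_add ?_ ?_)
    · rw [law, Measure.prod_prod, Measure.prod_prod, measure_univ, measure_univ, mul_one, one_mul]
      exact uniformSymbols_not_genericCoins_le S.alice S.bob T
    · refine (measure_biUnion_finset_le _ _).trans ?_
      rw [Nat.cast_sum, Finset.sum_mul]
      refine Finset.sum_le_sum fun t ht => ?_
      rw [Nat.cast_pow]
      exact law_hasFalseSolution_le hc hcbar hz hσ μ hlong hshort hm B W A (Finset.mem_Icc.1 ht).1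

/-- A lower bound of the session rate that holds outside of an event of probability `r`. -/
theorem le_lintegral_sessionRate {F : Type*} [Field F] [Fintype F] [MeasurableSpace F]
    (μ : Measure Ω) [IsProbabilityMeasure μ] (hb : 1 ≤ p.b)
    (hN : Measurable (S.cutTime p.b)) (B : BasisRule p ne F) (W : Message p F)
    (A : S.Calvin p F) {r : ENNReal}
    (hr : law μ p ne F {x | ¬ (S.Correct B W A x ∧ S.stopTime B W A x ≤ S.cutTime p.b x.1)} ≤ r) :
    ENNReal.ofReal (∫ ω, (p.b : ℝ) / S.cutTime p.b ω ∂μ)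
      ≤ ∫⁻ x, ENNReal.ofReal (S.sessionRate B W A x) ∂(law μ p ne F) + p.b * r := by
  set bad := {x : Sample Ω p ne F |
    ¬ (S.Correct B W A x ∧ S.stopTime B W A x ≤ S.cutTime p.b x.1)} with hbad
  -- The bad event is replaced by a measurable hull of equal probability, so its own measurability
  -- is not needed to split the integral.
  set G := toMeasurable (law μ p ne F) bad with hG
  have hle : ∀ ω, (p.b : ℝ) / S.cutTime p.b ω ≤ p.b := fun ω => by
    rcases Nat.eq_zero_or_pos (S.cutTime p.b ω) with h | h
    · simp [h]
    · exact div_le_self (by positivity) (by exact_mod_cast h)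
  have hrate : Measurable fun ω => (p.b : ℝ) / S.cutTime p.b ω :=
    (Measurable.of_discrete (f := fun N : ℕ => (p.b : ℝ) / N)).comp hN
  have hint : Integrable (fun ω => (p.b : ℝ) / S.cutTime p.b ω) μ :=
    Integrable.of_bound (C := p.b) hrate.aestronglyMeasurable <| ae_of_all _ fun ω => by
      rw [Real.norm_of_nonneg (by positivity)]
      exact hle ω
  have h1 : ENNReal.ofReal (∫ ω, (p.b : ℝ) / S.cutTime p.b ω ∂μ)
      = ∫⁻ x, ENNReal.ofReal ((p.b : ℝ) / S.cutTime p.b x.1) ∂(law μ p ne F) := by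
    rw [ofReal_integral_eq_lintegral_ofReal hint (ae_of_all _ fun ω => by positivity)]
    exact (measurePreserving_fst.lintegral_comp hrate.ennreal_ofReal).symm
  have hGm : MeasurableSet G := measurableSet_toMeasurable _ _
  rw [h1, ← lintegral_add_compl _ hGm.compl, compl_compl]
  refine add_le_add ?_ ?_
  · refine le_trans (setLIntegral_mono' hGm.compl fun x hx => ?_) (setLIntegral_le_lintegral _ _)
    have hx' : S.Correct B W A x ∧ S.stopTime B W A x ≤ S.cutTime p.b x.1 := by
      by_contra hno
      exact hx (subset_toMeasurable _ _ hno)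
    exact ENNReal.ofReal_le_ofReal (le_sessionRate hb B W A hx'.1 hx'.2)
  · calc ∫⁻ x in G, ENNReal.ofReal ((p.b : ℝ) / S.cutTime p.b x.1) ∂(law μ p ne F)
        ≤ ∫⁻ _ in G, (p.b : ENNReal) ∂(law μ p ne F) := lintegral_mono fun x => by
          rw [← ENNReal.ofReal_natCast]
          exact ENNReal.ofReal_le_ofReal (hle x.1)
      _ = p.b * law μ p ne F bad := by
          rw [setLIntegral_const, hG, measure_toMeasurable]
      _ ≤ p.b * r := by gcongr

end Main

end Environment

end RatelessCode

/-! ### Assembly of the four claims -/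

theorem mainTheorem4 {Ω : Type*} [MeasurableSpace Ω] (μ : Measure Ω) [IsProbabilityMeasure μ]
    {V : Type*} [Fintype V] {ne : ℕ} (S : RatelessCode.Environment Ω V ne)
    (b σ m cbar : ℕ) (hb : 1 ≤ b)
    (hlong_meas : ∀ k, Measurable (S.longNet k)) (hshort_meas : ∀ k, Measurable (S.shortNet k))
    (hz_meas : ∀ k, Measurable (S.z k)) (hzbar_meas : ∀ k, Measurable (S.zbar k))
    (hc : ∀ k ω, ((S.longNet k ω).out S.alice).card ≤ cbar)
    (hcbar : ∀ k ω, ((S.shortNet k ω).out S.alice).card ≤ cbar)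
    (hz : ∀ k ω, S.z k ω ≤ S.M k ω)
    (hσ : ∀ k ω, σ + S.zbar k ω ≤ S.Mbar k ω)
    (hm : 2 * b * cbar + 2 * σ * cbar + 1 ≤ σ * m)
    (hindep : iIndepFun (fun k ω => (S.M k ω, S.z k ω)) μ)
    (hident : ∀ k, IdentDistrib (fun ω => (S.M k ω, S.z k ω)) (fun ω => (S.M 0 ω, S.z 0 ω)) μ μ)
    (ε : ℝ) (hε : 0 < ε) (hdrift : ε ≤ (∫ ω, (S.M 0 ω : ℝ) ∂μ) - ∫ ω, (S.z 0 ω : ℝ) ∂μ) :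
    -- the cut set bound is met after finitely many stages
    (∀ᵐ ω ∂μ, ∃ t : ℕ,
      b + ∑ k ∈ Finset.range t, S.z k ω ≤ ∑ k ∈ Finset.range t, S.M k ω) ∧
    -- the average rate
    (b : ℝ) / ((b : ℝ) + cbar - 1) * ((∫ ω, (S.M 0 ω : ℝ) ∂μ) - ∫ ω, (S.z 0 ω : ℝ) ∂μ)
      ≤ ∫ ω, (b : ℝ) / S.cutTime b ω ∂μ ∧
    -- correct decoding with high probability, no later than at the stage where the cut set bound
    -- is met, and the average rate of the sessions themselves
    (∀ (n : ℕ) (δ : ℝ), 0 < δ → ∃ q₀ : ℕ, ∀ (F : Type*) [Field F] [Fintype F] [MeasurableSpace F]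
      [DiscreteMeasurableSpace F], q₀ ≤ Fintype.card F →
      ∀ (B : RatelessCode.BasisRule ⟨b, n, σ, m⟩ ne F) (W : RatelessCode.Message ⟨b, n, σ, m⟩ F)
        (A : S.Calvin ⟨b, n, σ, m⟩ F),
        RatelessCode.Environment.law μ ⟨b, n, σ, m⟩ ne F
            {x | ¬ (S.Correct B W A x ∧ S.stopTime B W A x ≤ S.cutTime b x.1)}
          ≤ ENNReal.ofReal δ ∧
        ENNReal.ofReal ((b : ℝ) / ((b : ℝ) + cbar - 1) *
            ((∫ ω, (S.M 0 ω : ℝ) ∂μ) - ∫ ω, (S.z 0 ω : ℝ) ∂μ) - δ)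
          ≤ ∫⁻ x, ENNReal.ofReal (S.sessionRate B W A x)
              ∂(RatelessCode.Environment.law μ ⟨b, n, σ, m⟩ ne F)) ∧
    -- the redundant columns and the short packets are negligible for long messages
    Tendsto (fun n : ℕ => ∫ ω, ((b : ℝ) * n) /
        (∑ k ∈ Finset.range (S.cutTime b ω),
          (((n : ℝ) + b) + ((k : ℝ) + 1) * (m + σ))) ∂μ)
      atTop (𝓝 (∫ ω, (b : ℝ) / S.cutTime b ω ∂μ)) := by

  classical
  have hM_meas : ∀ k, Measurable (S.M k) := fun k =>
    (Measurable.of_discrete (f := fun N : RatelessCode.Network V ne =>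
      N.capacity S.alice S.bob)).comp (hlong_meas k)
  have hM_le : ∀ k ω, S.M k ω ≤ cbar := S.M_le_of_card_out_le hc
  have hz_le : ∀ k ω, S.z k ω ≤ cbar := fun k ω => (hz k ω).trans (hM_le k ω)
  -- Truncated subtraction loses nothing here, since z ≤ M pointwise.
  let X : ℕ → Ω → ℕ := fun k ω => S.M k ω - S.z k ω
  have hX : ∀ k, Measurable (X k) := fun k => (hM_meas k).sub (hz_meas k)
  have hXc : ∀ k ω, X k ω ≤ cbar := fun k ω => (Nat.sub_le _ _).trans (hM_le k ω)
  have hXindep : iIndepFun X μ :=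
    hindep.comp (fun _ z => z.1 - z.2) fun _ => Measurable.of_discrete
  have hXident : ∀ k, IdentDistrib (X k) (X 0) μ μ := fun k =>
    (hident k).comp (u := fun z : ℕ × ℕ => z.1 - z.2) Measurable.of_discrete
  have hmean : ∫ ω, (X 0 ω : ℝ) ∂μ = (∫ ω, (S.M 0 ω : ℝ) ∂μ) - ∫ ω, (S.z 0 ω : ℝ) ∂μ := by
    rw [← integral_sub (RatelessCode.integrable_natCast_of_le (hM_meas 0) (hM_le 0))
      (RatelessCode.integrable_natCast_of_le (hz_meas 0) (hz_le 0))]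
    exact integral_congr_ae <| ae_of_all _ fun ω => Nat.cast_sub (hz 0 ω)
  have hpos : 0 < ∫ ω, (X 0 ω : ℝ) ∂μ := by
    rw [hmean]
    exact hε.trans_le hdrift
  have hcut : S.cutTime b = fun ω => RatelessCode.passageTime b fun k => X k ω :=
    funext (S.cutTime_eq_passageTime hz b)
  have hN : Measurable (S.cutTime b) := by
    rw [hcut]
    exact RatelessCode.measurable_passageTime hX b
  have hrate : (b : ℝ) / ((b : ℝ) + cbar - 1) *
      ((∫ ω, (S.M 0 ω : ℝ) ∂μ) - ∫ ω, (S.z 0 ω : ℝ) ∂μ) ≤ ∫ ω, (b : ℝ) / S.cutTime b ω ∂μ := by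
    rw [hcut, ← hmean]
    exact RatelessCode.rate_le_integral_passageTime hX hb hXc hXindep hXident hpos
  refine ⟨?_, hrate, fun n δ hδ => ?_, ?_⟩
  · filter_upwards [RatelessCode.ae_exists_le_walk hX hb hXc hXindep hXident hpos] with ω hω
    obtain ⟨t, ht⟩ := hω
    refine ⟨t, ?_⟩
    have h : ∑ k ∈ Finset.range t, X k ω + ∑ k ∈ Finset.range t, S.z k ω
        = ∑ k ∈ Finset.range t, S.M k ω := by
      rw [← Finset.sum_add_distrib]
      exact Finset.sum_congr rfl fun k _ => Nat.sub_add_cancel (hz k ω)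
    omega
  · have hb0 : (0 : ℝ) < b := by exact_mod_cast hb
    -- One tolerance for two purposes: η ≤ δ bounds the error probability and bη ≤ δ bounds the loss
    -- of rate, as the rate never exceeds b.
    set η := δ / (b + 1) with hη
    have hη0 : 0 < η := by positivity
    have hηδ : η ≤ δ := div_le_self hδ.le (by linarith)
    have hbη : b * η ≤ δ := by
      rw [hη, mul_div_assoc', div_le_iff₀ (by positivity)]
      nlinarith
    -- The horizon comes from the walk alone and uses half of η; it is fixed before q, so the
    -- constant C below does not depend on the field.
    obtain ⟨T, hT⟩ := RatelessCode.exists_measureReal_walk_lt_le hX hb hXc hXindep hXident hpos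
      (half_pos hη0)
    set C := RatelessCode.Environment.errorCount V ne ⟨b, n, σ, m⟩ T with hC
    -- The other half of η pays for C/q.
    obtain ⟨q₀, hq₀⟩ := exists_nat_ge ((C : ℝ) / (η / 2))
    refine ⟨q₀, fun F _ _ _ _ hq B W A => ?_⟩
    have hq1 : (C : ENNReal) * (1 / Fintype.card F) ≤ ENNReal.ofReal (η / 2) := by
      have hq0 : (0 : ℝ) < Fintype.card F := by exact_mod_cast Fintype.card_pos
      have h1 : (C : ℝ) / Fintype.card F ≤ η / 2 := by
        rw [div_le_iff₀ hq0]
        rw [div_le_iff₀ (half_pos hη0)] at hq₀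
        have h2 : (q₀ : ℝ) ≤ Fintype.card F := by exact_mod_cast hq
        nlinarith
      refine le_trans (le_of_eq ?_) (ENNReal.ofReal_le_ofReal h1)
      rw [ENNReal.ofReal_div_of_pos hq0, ENNReal.ofReal_natCast, ENNReal.ofReal_natCast,
        mul_one_div]
    have hbad : RatelessCode.Environment.law μ ⟨b, n, σ, m⟩ ne F
        {x | ¬ (S.Correct B W A x ∧ S.stopTime B W A x ≤ S.cutTime b x.1)}
          ≤ ENNReal.ofReal η := by
      refine (RatelessCode.Environment.law_not_correct_le (p := ⟨b, n, σ, m⟩) hc hcbar hz hσ μ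
        hlong_meas hshort_meas hb hm B W A T).trans ?_
      rw [← add_halves η, ENNReal.ofReal_add (half_pos hη0).le (half_pos hη0).le]
      refine add_le_add ?_ hq1
      rw [← ofReal_measureReal]
      exact ENNReal.ofReal_le_ofReal hT
    refine ⟨hbad.trans (ENNReal.ofReal_le_ofReal hηδ), ?_⟩
    have h1 := RatelessCode.Environment.le_lintegral_sessionRate (p := ⟨b, n, σ, m⟩) μ hb hN B W A
      hbad
    rw [ENNReal.ofReal_sub _ hδ.le, tsub_le_iff_right]
    refine (ENNReal.ofReal_le_ofReal hrate).trans (h1.trans (add_le_add le_rfl ?_))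
    rw [← ENNReal.ofReal_natCast, ← ENNReal.ofReal_mul hb0.le]
    exact ENNReal.ofReal_le_ofReal hbη
  · have := RatelessCode.tendsto_integral_rate_with_overhead (μ := μ) hN b (m + σ)
    simpa only [Nat.cast_add] using this
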